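/- Let $(M,g)$ be a spherically symmetric spacetime of signature $(-,+,+,+)$, in local coordinates adapted to the symmetry $$ds^2 = g_{00}\,(dx^0)^2+2g_{01}\,dx^0dx^1+g_{11}\,(dx^1)^2+R^2(d\theta^2+\sin^2\theta\,d\varphi^2),\qquad 0<\theta<\pi,$$ where the coefficients and the area radius $R>0$ are $C^2$ functions of $(x^0,x^1)$ and the metric on the $(x^0,x^1)$-space is Lorentzian. Let $u^a$ (unit timelike) and $e^a$ (unit spacelike, orthogonal to $u^a$) be $C^1$ spherically symmetric vector fields orthogonal to the spheres, and let $T_{ab}$ satisfy Einstein's equations $R_{ab}-\frac12\mathcal R\,g_{ab}=T_{ab}$, where $R_{ab}$ and $\mathcal R$ are the Ricci tensor and the Ricci scalar (the factor $8\pi$ is absorbed in $T_{ab}$). Put $h_{ab}=g_{ab}+u_au_b$ and $N_{ab}=h_{ab}-e_ae_b$; let $D$ and $\delta$ be the covariant derivative fully projected with $h$ and with $N$, respectively, and let $W_{\langle ab\rangle}=\big(h^c{}_{(a}h^d{}_{b)}-\frac13h_{ab}h^{cd}\big)W_{cd}$. Define $$\Theta=D_au^a,\quad \Sigma=\sigma_{ab}e^ae^b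 \text{ with } \sigma_{ab}=D_{\langle a}u_{b\rangle},\quad \phi=\delta_ae^a,\quad \mathcal E=C_{acbd}\,e^au^ce^bu^d,\quad \mu=T_{ab}u^au^b,\quad \Pi=T_{\langle ab\rangle}e^ae^b,$$ where $C_{abcd}$ is the Weyl tensor. Let $\mathcal M=\frac R2\,(1-\nabla_aR\,\nabla^aR)$ be the Misner–Sharp mass, $\alpha=\mathcal M/R$, and $$\langle T\rangle_{\rm geom}=\phi^2-\Big(\Sigma-\frac23\Theta\Big)^2,\qquad \langle V\rangle_{\rm geom}=\frac13\mu-\mathcal E-\frac12\Pi .$$ Then at every point: 1. if $\alpha\neq0$, then $$\phi^2-\Big(\Sigma-\frac23\Theta\Big)^2=\frac{2(1-2\alpha)}{\alpha}\Big[\frac13\mu-\mathcal E-\frac12\Pi\Big],$$ and for every value of $\alpha$, $\ \alpha\,\langle T\rangle_{\rm geom}=2(1-2\alpha)\,\langle V\rangle_{\rm geom}$; 2. at the Buchdahl value $\alpha=\frac49$ the coefficient $\frac{2(1-2\alpha)}{\alpha}$ equals $\frac12$, and $\langle T\rangle_{\rm geom}=\frac12\langle V\rangle_{\rm geom}$ holds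 if and only if $\alpha=\frac49$; 3. $\langle T\rangle_{\rm geom}=0$ if and only if $\alpha=\frac12$, and this is the horizon condition: $\langle T\rangle_{\rm geom}=0$ if and only if the symmetry sphere through the point is marginally trapped, i.e. $N^{ab}\nabla_ak_b=0$ for one of its two null normals $k=u+e$, $k=u-e$. -/

import Mathlib

/-
Local Lorentzian geometry in coordinates on four-dimensional coordinate space, signature
`(-, +, +, +)`, the scalars of the `1+1+2` decomposition, and spherically symmetric spacetimes.
-/

namespace OneOneTwo

noncomputable section

/-- Coordinate space; a point is its tuple of coordinates. -/
abbrev Pt : Type := Fin 4 → ℝ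

/-- Fields of tangent vectors, in components `v^a`. -/
abbrev VField : Type := Pt → Fin 4 → ℝ

/-- Fields of covariant two-tensors, in components `W_{ab}`. -/
abbrev Tensor2 : Type := Pt → Matrix (Fin 4) (Fin 4) ℝ

/-- Partial derivative `∂_a f`. -/
def pd (a : Fin 4) (f : Pt → ℝ) (x : Pt) : ℝ := fderiv ℝ f x (Pi.single a 1)

/-! ### Connection and curvature of a metric `g_{ab}` -/

/-- Inverse metric `g^{ab}`. -/
def inv (g : Tensor2) : Tensor2 := fun x => (g x)⁻¹

/-- Christoffel symbols `Γ^a_{bc}` of the Levi-Civita connection. -/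
def christoffel (g : Tensor2) (a b c : Fin 4) (x : Pt) : ℝ :=
  (1 / 2) * ∑ d, inv g x a d *
    (pd b (fun y => g y d c) x + pd c (fun y => g y d b) x - pd d (fun y => g y b c) x)

/-- Riemann tensor `R^a_{bcd}`, with
`R^a_{bcd} = ∂_c Γ^a_{db} - ∂_d Γ^a_{cb} + Γ^a_{ce} Γ^e_{db} - Γ^a_{de} Γ^e_{cb}`. -/
def riemannUp (g : Tensor2) (a b c d : Fin 4) (x : Pt) : ℝ :=
  pd c (christoffel g a d b) x - pd d (christoffel g a c b) x
    + ∑ k, (christoffel g a c k x * christoffel g k d b x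
      - christoffel g a d k x * christoffel g k c b x)

/-- Riemann tensor `R_{abcd}` with all indices down. -/
def riemann (g : Tensor2) (a b c d : Fin 4) (x : Pt) : ℝ :=
  ∑ k, g x a k * riemannUp g k b c d x

/-- Ricci tensor `R_{bd} = R^a_{bad}`. -/
def ricci (g : Tensor2) (b d : Fin 4) (x : Pt) : ℝ := ∑ a, riemannUp g a b a d x

/-- Ricci scalar. -/
def scalarCurv (g : Tensor2) (x : Pt) : ℝ := ∑ a, ∑ b, inv g x a b * ricci g a b x

/-- Einstein tensor `G_{ab}`. -/
def einstein (g : Tensor2) : Tensor2 :=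
  fun x => Matrix.of fun a b => ricci g a b x - (1 / 2) * scalarCurv g x * g x a b

/-- Weyl tensor `C_{abcd}` (in dimension four). -/
def weyl (g : Tensor2) (a b c d : Fin 4) (x : Pt) : ℝ :=
  riemann g a b c d x
    - (1 / 2) * (g x a c * ricci g b d x - g x a d * ricci g b c x
        - g x b c * ricci g a d x + g x b d * ricci g a c x)
    + (1 / 6) * scalarCurv g x * (g x a c * g x b d - g x a d * g x b c)

/-- Lowering an index: `v_a = g_{ab} v^b`. -/
def lower (g : Tensor2) (v : VField) : VField := fun x a => ∑ b, g x a b * v x b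

/-- Covariant derivative `∇_b v^a` of a vector field. -/
def covVec (g : Tensor2) (v : VField) (b a : Fin 4) (x : Pt) : ℝ :=
  pd b (fun y => v y a) x + ∑ c, christoffel g a b c x * v x c

/-- Covariant derivative `∇_b w_a` of a covector field. -/
def covCovec (g : Tensor2) (w : VField) (b a : Fin 4) (x : Pt) : ℝ :=
  pd b (fun y => w y a) x - ∑ c, christoffel g c b a x * w x c

/-- Squared length `∇_a f ∇^a f` of the gradient of a scalar field. -/
def gradSq (g : Tensor2) (f : Pt → ℝ) (x : Pt) : ℝ :=
  ∑ a, ∑ b, inv g x a b * pd a f x * pd b f x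

/-! ### Projections and projected derivatives, for a pair of vector fields `u`, `e` -/

/-- `h_{ab} = g_{ab} + u_a u_b`. -/
def hDown (g : Tensor2) (u : VField) (a b : Fin 4) (x : Pt) : ℝ :=
  g x a b + lower g u x a * lower g u x b

/-- `h^{ab} = g^{ab} + u^a u^b`. -/
def hUp (g : Tensor2) (u : VField) (a b : Fin 4) (x : Pt) : ℝ :=
  inv g x a b + u x a * u x b

/-- `h^a_b = δ^a_b + u^a u_b`, the projection orthogonal to `u`. -/
def hMix (g : Tensor2) (u : VField) (a b : Fin 4) (x : Pt) : ℝ :=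
  (if a = b then 1 else 0) + u x a * lower g u x b

/-- `N^a_b = δ^a_b + u^a u_b - e^a e_b`, the projection on the two-sheet. -/
def nMix (g : Tensor2) (u e : VField) (a b : Fin 4) (x : Pt) : ℝ :=
  hMix g u a b x - e x a * lower g e x b

/-- `N^{ab} = g^{ab} + u^a u^b - e^a e^b`. -/
def nUp (g : Tensor2) (u e : VField) (a b : Fin 4) (x : Pt) : ℝ :=
  hUp g u a b x - e x a * e x b

/-- `D_b v^a = h^r_b h^a_f ∇_r v^f`. -/
def dVec (g : Tensor2) (u : VField) (v : VField) (b a : Fin 4) (x : Pt) : ℝ :=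
  ∑ r, ∑ f, hMix g u r b x * hMix g u a f x * covVec g v r f x

/-- `D_b w_a = h^r_b h^f_a ∇_r w_f`. -/
def dCovec (g : Tensor2) (u : VField) (w : VField) (b a : Fin 4) (x : Pt) : ℝ :=
  ∑ r, ∑ f, hMix g u r b x * hMix g u f a x * covCovec g w r f x

/-- `δ_b v^a = N^j_b N^a_i D_j v^i`. -/
def deltaVec (g : Tensor2) (u e : VField) (v : VField) (b a : Fin 4) (x : Pt) : ℝ :=
  ∑ j, ∑ i, nMix g u e j b x * nMix g u e a i x * dVec g u v j i x

/-- The projected symmetric trace-free part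
`W_{<ab>} = (h^c_{(a} h^d_{b)} - (1/3) h_{ab} h^{cd}) W_{cd}`. -/
def pstf (g : Tensor2) (u : VField) (W : Fin 4 → Fin 4 → ℝ) (a b : Fin 4) (x : Pt) : ℝ :=
  ∑ c, ∑ d, ((1 / 2) * (hMix g u c a x * hMix g u d b x + hMix g u c b x * hMix g u d a x)
    - (1 / 3) * hDown g u a b x * hUp g u c d x) * W c d

/-- The scalar `W_{ab} e^a e^b`. -/
def alongE (e : VField) (W : Fin 4 → Fin 4 → ℝ) (x : Pt) : ℝ :=
  ∑ a, ∑ b, W a b * e x a * e x b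

/-! ### The covariant scalars -/

/-- Expansion `Θ = D_a u^a`. -/
def expansion (g : Tensor2) (u : VField) (x : Pt) : ℝ := ∑ a, dVec g u u a a x

/-- Shear `σ_{ab} = (h^c_{(a} h^d_{b)} - (1/3) h_{ab} h^{cd}) D_c u_d`. -/
def shear (g : Tensor2) (u : VField) (a b : Fin 4) (x : Pt) : ℝ :=
  pstf g u (fun c d => dCovec g u (lower g u) c d x) a b x

/-- `Σ = σ_{ab} e^a e^b`. -/
def shearScalar (g : Tensor2) (u e : VField) (x : Pt) : ℝ :=
  alongE e (fun a b => shear g u a b x) x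

/-- Sheet expansion `φ = δ_a e^a`. -/
def sheetExpansion (g : Tensor2) (u e : VField) (x : Pt) : ℝ :=
  ∑ a, deltaVec g u e e a a x

/-- Electric part of the Weyl tensor, `E_{ab} = C_{acbd} u^c u^d`. -/
def electricWeyl (g : Tensor2) (u : VField) (a b : Fin 4) (x : Pt) : ℝ :=
  ∑ c, ∑ d, weyl g a c b d x * u x c * u x d

/-- `𝓔 = E_{ab} e^a e^b`. -/
def weylScalar (g : Tensor2) (u e : VField) (x : Pt) : ℝ :=
  alongE e (fun a b => electricWeyl g u a b x) x

/-- Energy density `μ = T_{ab} u^a u^b`. -/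
def energyDensity (u : VField) (T : Tensor2) (x : Pt) : ℝ :=
  ∑ a, ∑ b, T x a b * u x a * u x b

/-- Anisotropic stress `π_{ab} = T_{cd} h^c_{<a} h^d_{b>}`. -/
def anisoStress (g : Tensor2) (u : VField) (T : Tensor2) (a b : Fin 4) (x : Pt) : ℝ :=
  pstf g u (fun c d => T x c d) a b x

/-- `Π = π_{ab} e^a e^b`. -/
def anisoScalar (g : Tensor2) (u e : VField) (T : Tensor2) (x : Pt) : ℝ :=
  alongE e (fun a b => anisoStress g u T a b x) x

/-- `⟨T⟩_geom = φ² - (Σ - (2/3) Θ)²`. -/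
def kineticGeom (g : Tensor2) (u e : VField) (x : Pt) : ℝ :=
  sheetExpansion g u e x ^ 2 - (shearScalar g u e x - (2 / 3) * expansion g u x) ^ 2

/-- `⟨V⟩_geom = (1/3) μ - 𝓔 - (1/2) Π`. -/
def potentialGeom (g : Tensor2) (u e : VField) (T : Tensor2) (x : Pt) : ℝ :=
  (1 / 3) * energyDensity u T x - weylScalar g u e x - (1 / 2) * anisoScalar g u e T x

/-- Expansion `N^{ab} ∇_a k_b` of the two-sheets along a vector field `k`. -/
def sheetExpansionAlong (g : Tensor2) (u e k : VField) (x : Pt) : ℝ :=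
  ∑ a, ∑ b, nUp g u e a b x * covCovec g (lower g k) a b x

/-- The sheet through `x` is marginally trapped (a horizon section): its expansion along one of
its two null normals `u + e`, `u - e` vanishes. -/
def IsHorizonAt (g : Tensor2) (u e : VField) (x : Pt) : Prop :=
  sheetExpansionAlong g u e (fun y a => u y a + e y a) x = 0 ∨
    sheetExpansionAlong g u e (fun y a => u y a - e y a) x = 0

/-! ### Spherically symmetric spacetimes -/

/-- A spherically symmetric spacetime, in coordinates `(x⁰, x¹, θ, ϕ)` adapted to the symmetry:
`ds² = g₀₀ (dx⁰)² + 2 g₀₁ dx⁰ dx¹ + g₁₁ (dx¹)² + R² (dθ² + sin² θ dϕ²)`, where the coefficients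
and the area radius `R > 0` are functions of `(x⁰, x¹)` and the metric
`g₀₀ (dx⁰)² + 2 g₀₁ dx⁰ dx¹ + g₁₁ (dx¹)²` on the space of orbits is an arbitrary Lorentzian
one. -/
structure SphericalSpacetime where
  /-- range of the coordinates `(x⁰, x¹)` -/
  base : Set (ℝ × ℝ)
  isOpen_base : IsOpen base
  g00 : ℝ × ℝ → ℝ
  g01 : ℝ × ℝ → ℝ
  g11 : ℝ × ℝ → ℝ
  /-- area radius of the orbits -/
  R : ℝ × ℝ → ℝ
  contDiffOn_g00 : ContDiffOn ℝ 2 g00 base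
  contDiffOn_g01 : ContDiffOn ℝ 2 g01 base
  contDiffOn_g11 : ContDiffOn ℝ 2 g11 base
  contDiffOn_R : ContDiffOn ℝ 2 R base
  lorentzian : ∀ p ∈ base, g00 p * g11 p - g01 p ^ 2 < 0
  R_pos : ∀ p ∈ base, 0 < R p

namespace SphericalSpacetime

variable (S : SphericalSpacetime)

/-- The coordinate domain (polar coordinates on the spheres: `0 < θ < π`). -/
def domain : Set Pt := {x | (x 0, x 1) ∈ S.base ∧ 0 < x 2 ∧ x 2 < Real.pi}

/-- The metric `g_{ab}`. -/
def metric : Tensor2 := fun x =>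
  !![S.g00 (x 0, x 1), S.g01 (x 0, x 1), 0, 0;
     S.g01 (x 0, x 1), S.g11 (x 0, x 1), 0, 0;
     0, 0, S.R (x 0, x 1) ^ 2, 0;
     0, 0, 0, S.R (x 0, x 1) ^ 2 * Real.sin (x 2) ^ 2]

/-- The area radius as a scalar field on the spacetime. -/
def radius (x : Pt) : ℝ := S.R (x 0, x 1)

/-- Misner–Sharp mass `M = (R / 2) (1 - ∇_a R ∇^a R)`. -/
def mass (x : Pt) : ℝ := S.radius x / 2 * (1 - gradSq S.metric S.radius x)

/-- Compactness `α = M / R`. -/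
def compactness (x : Pt) : ℝ := S.mass x / S.radius x

/-- Einstein's field equations `R_{ab} - (1/2) R g_{ab} = T_{ab}`, the constant `8π` being absorbed
in the energy-momentum tensor. -/
def FieldEquations (T : Tensor2) : Prop :=
  ∀ x ∈ S.domain, T x = einstein S.metric x

/-- A choice of the preferred vector fields: spherically symmetric fields `u` (unit, timelike) and
`e` (unit, spacelike, orthogonal to `u`), both orthogonal to the spheres. -/
structure RadialFrame where
  u0 : ℝ × ℝ → ℝ
  u1 : ℝ × ℝ → ℝ
  e0 : ℝ × ℝ → ℝ
  e1 : ℝ × ℝ → ℝ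
  contDiffOn_u0 : ContDiffOn ℝ 1 u0 S.base
  contDiffOn_u1 : ContDiffOn ℝ 1 u1 S.base
  contDiffOn_e0 : ContDiffOn ℝ 1 e0 S.base
  contDiffOn_e1 : ContDiffOn ℝ 1 e1 S.base
  unit_u : ∀ p ∈ S.base,
    S.g00 p * u0 p ^ 2 + 2 * S.g01 p * u0 p * u1 p + S.g11 p * u1 p ^ 2 = -1
  unit_e : ∀ p ∈ S.base,
    S.g00 p * e0 p ^ 2 + 2 * S.g01 p * e0 p * e1 p + S.g11 p * e1 p ^ 2 = 1
  orthogonal : ∀ p ∈ S.base,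
    S.g00 p * u0 p * e0 p + S.g01 p * (u0 p * e1 p + u1 p * e0 p) + S.g11 p * u1 p * e1 p = 0

variable {S}

/-- The timelike field `u^a`. -/
def RadialFrame.u (F : S.RadialFrame) : VField :=
  fun x => ![F.u0 (x 0, x 1), F.u1 (x 0, x 1), 0, 0]

/-- The preferred spacelike field `e^a`. -/
def RadialFrame.e (F : S.RadialFrame) : VField :=
  fun x => ![F.e0 (x 0, x 1), F.e1 (x 0, x 1), 0, 0]

end SphericalSpacetime

end

end OneOneTwo

open OneOneTwo

/-! Everything is governed by two scalars, the area radius `R` and `G = ∇_a R ∇^a R`. By definition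
of the Misner–Sharp mass, `α = (1 - G)/2`. It is enough to show `⟨T⟩ = 4G/R²` and `⟨V⟩ = (1 -
G)/R²`: then `⟨T⟩ = 4(1 - 2α)/R²` and `⟨V⟩ = 2α/R²`, and all the claims are algebra in `α`.

Kinetic side (`kineticGeom_eq`): each angular direction contributes `v(R)/R` to the divergence of a
field `v` orthogonal to the spheres. Hence `φ = 2e(R)/R`, and in `Σ - (2/3)Θ` the radial part `e^a
e^b ∇_a u_b` cancels, leaving `-2u(R)/R`. Since the inverse orbit metric is `-uu + ee`, `G = e(R)² -
u(R)²`. The expansions along `u ± e` are `2(u(R) ± e(R))/R`, with product `-4G/R²`, so a horizon is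
the same as `G = 0`.

Potential side (`potentialGeom_eq`): the spacetime is a warped product of a Lorentzian surface with
the sphere, so its curvature is made of the Gaussian curvature `K` of the orbit space, the Hessian
of `R`, and `(1 - G)/R²`. With the field equations, `μ`, `𝓔` and `Π` become combinations of these,
and in `⟨V⟩` both `K` and the Hessian drop out.

The curvature is computed from the coordinate Christoffel symbols. Derivatives of the orbit
connection are never expanded: metric compatibility and commuting second partials give the one
symmetry of the curvature that is needed. -/

namespace OneOneTwo

/-! ### Calculus of partial derivatives. -/

/-- `f` is differentiable at `x` with partial derivatives `v`. -/
def HasGrad (f : Pt → ℝ) (v : Fin 4 → ℝ) (x : Pt) : Prop :=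
  DifferentiableAt ℝ f x ∧ ∀ a, pd a f x = v a

namespace HasGrad

variable {f h : Pt → ℝ} {v w : Fin 4 → ℝ} {x : Pt}

theorem of_differentiableAt (hf : DifferentiableAt ℝ f x) : HasGrad f (fun a => pd a f x) x :=
  ⟨hf, fun _ => rfl⟩

theorem pd_eq (hf : HasGrad f v x) (a : Fin 4) : pd a f x = v a := hf.2 a

theorem const (r : ℝ) : HasGrad (fun _ => r) (fun _ => 0) x :=
  ⟨differentiableAt_const r, fun a => by simp [pd]⟩

theorem add (hf : HasGrad f v x) (hh : HasGrad h w x) :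
    HasGrad (fun y => f y + h y) (fun a => v a + w a) x :=
  ⟨hf.1.add hh.1, fun a => by
    change _ = v a + w a
    have e := fderiv_add hf.1 hh.1
    rw [← hf.2, ← hh.2, pd, show (fun y => f y + h y) = f + h from rfl, e]; rfl⟩

theorem sub (hf : HasGrad f v x) (hh : HasGrad h w x) :
    HasGrad (fun y => f y - h y) (fun a => v a - w a) x :=
  ⟨hf.1.sub hh.1, fun a => by
    change _ = v a - w a
    have e := fderiv_sub hf.1 hh.1
    rw [← hf.2, ← hh.2, pd, show (fun y => f y - h y) = f - h from rfl, e]; rfl⟩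

theorem neg (hf : HasGrad f v x) : HasGrad (fun y => -f y) (fun a => -v a) x :=
  ⟨hf.1.neg, fun a => by
    change _ = -v a
    rw [← hf.2, pd, show (fun y => -f y) = -f from rfl, fderiv_neg]; rfl⟩

theorem mul (hf : HasGrad f v x) (hh : HasGrad h w x) :
    HasGrad (fun y => f y * h y) (fun a => v a * h x + f x * w a) x :=
  ⟨hf.1.mul hh.1, fun a => by
    change _ = v a * h x + f x * w a
    have e := fderiv_mul hf.1 hh.1
    rw [← hf.2, ← hh.2, pd, show (fun y => f y * h y) = f * h from rfl, e]
    simp [pd]; ring⟩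

theorem inv (hh : HasGrad h w x) (h0 : h x ≠ 0) :
    HasGrad (fun y => (h y)⁻¹) (fun a => -w a / h x ^ 2) x := by
  have e : HasFDerivAt (fun y => (h y)⁻¹) _ x :=
    (hasDerivAt_inv h0).comp_hasFDerivAt x hh.1.hasFDerivAt
  refine ⟨e.differentiableAt, fun a => ?_⟩
  change _ = -w a / h x ^ 2
  rw [← hh.2, pd, e.fderiv]
  simp [pd]
  field_simp

theorem div (hf : HasGrad f v x) (hh : HasGrad h w x) (h0 : h x ≠ 0) :
    HasGrad (fun y => f y / h y) (fun a => (v a * h x - f x * w a) / h x ^ 2) x := by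
  obtain ⟨h1, h2⟩ := hf.mul (hh.inv h0)
  refine ⟨h1, fun a => (h2 a).trans ?_⟩
  field_simp
  ring

theorem congr (hf : HasGrad f v x) (he : h =ᶠ[nhds x] f) : HasGrad h v x :=
  ⟨hf.1.congr_of_eventuallyEq he, fun a => by rw [← hf.2, pd, he.fderiv_eq]; rfl⟩

theorem congr_grad (hf : HasGrad f v x) (he : ∀ a, v a = w a) : HasGrad f w x :=
  ⟨hf.1, fun a => (hf.2 a).trans (he a)⟩

theorem sin_two : HasGrad (fun y => Real.sin (y 2)) ![0, 0, Real.cos (x 2), 0] x := by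
  have h1 : HasFDerivAt (fun y : Pt => y 2) (ContinuousLinearMap.proj (R := ℝ) 2) x :=
    hasFDerivAt_apply 2 x
  refine ⟨h1.sin.differentiableAt, fun a => ?_⟩
  rw [pd, h1.sin.fderiv]
  fin_cases a <;> simp

theorem cos_two : HasGrad (fun y => Real.cos (y 2)) ![0, 0, -Real.sin (x 2), 0] x := by
  have h1 : HasFDerivAt (fun y : Pt => y 2) (ContinuousLinearMap.proj (R := ℝ) 2) x :=
    hasFDerivAt_apply 2 x
  refine ⟨h1.cos.differentiableAt, fun a => ?_⟩
  rw [pd, h1.cos.fderiv]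
  fin_cases a <;> simp

end HasGrad

/-! ### Functions pulled back from the orbit space. -/

/-- The projection to the orbit space. -/
def orbitProj : Pt →L[ℝ] ℝ × ℝ :=
  (ContinuousLinearMap.proj (R := ℝ) (φ := fun _ : Fin 4 => ℝ) 0).prod
    (ContinuousLinearMap.proj (R := ℝ) (φ := fun _ : Fin 4 => ℝ) 1)

/-- The pullback of a function on the orbit space. -/
def radial (f : ℝ × ℝ → ℝ) : Pt → ℝ := fun y => f (y 0, y 1)

theorem pd_radial {f : ℝ × ℝ → ℝ} {x : Pt} (hf : DifferentiableAt ℝ f (x 0, x 1)) (a : Fin 4) :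
    pd a (radial f) x = fderiv ℝ f (x 0, x 1) (orbitProj (Pi.single a 1)) := by
  have h : HasFDerivAt (radial f) ((fderiv ℝ f (x 0, x 1)).comp orbitProj) x :=
    HasFDerivAt.comp (g := f) (f := orbitProj) x hf.hasFDerivAt orbitProj.hasFDerivAt
  rw [pd, h.fderiv]; rfl

theorem orbitProj_two : orbitProj (Pi.single 2 1) = 0 := by
  ext <;> simp [orbitProj]

theorem orbitProj_three : orbitProj (Pi.single 3 1) = 0 := by
  ext <;> simp [orbitProj]

theorem HasGrad.radial {f : ℝ × ℝ → ℝ} {x : Pt} (hf : DifferentiableAt ℝ f (x 0, x 1)) :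
    HasGrad (radial f) ![pd 0 (radial f) x, pd 1 (radial f) x, 0, 0] x := by
  refine ⟨DifferentiableAt.comp (g := f) (f := orbitProj) x hf orbitProj.differentiableAt,
    fun a => ?_⟩
  fin_cases a
  · rfl
  · rfl
  · simp [pd_radial hf, orbitProj_two]
  · simp [pd_radial hf, orbitProj_three]

/-- Second partial derivatives of the pullback of a `C²` function on the orbit space. -/
theorem HasGrad.pd_radial {f : ℝ × ℝ → ℝ} {s : Set (ℝ × ℝ)} (hs : IsOpen s)
    (hf : ContDiffOn ℝ 2 f s) {x : Pt} (hx : (x 0, x 1) ∈ s) (a : Fin 4) :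
    HasGrad (pd a (OneOneTwo.radial f))
      ![pd 0 (pd a (OneOneTwo.radial f)) x, pd 1 (pd a (OneOneTwo.radial f)) x, 0, 0] x := by
  set k : ℝ × ℝ → ℝ := fun p => fderiv ℝ f p (orbitProj (Pi.single a 1)) with hk
  have hc : ContDiffAt ℝ 2 f (x 0, x 1) := hf.contDiffAt (hs.mem_nhds hx)
  have hd : DifferentiableAt ℝ k (x 0, x 1) := by
    have h1 : ContDiffAt ℝ 1 (fderiv ℝ f) (x 0, x 1) := hc.fderiv_right (by norm_num)
    exact (h1.differentiableAt (by norm_num)).clm_apply (differentiableAt_const _)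
  -- The first partial is again a pullback, but only over the open set `s` where `f` is
  -- differentiable; germs suffice to differentiate once more.
  have he : pd a (OneOneTwo.radial f) =ᶠ[nhds x] OneOneTwo.radial k := by
    have hn : orbitProj ⁻¹' s ∈ nhds x :=
      orbitProj.continuous.continuousAt.preimage_mem_nhds (hs.mem_nhds hx)
    filter_upwards [hn] with y hy
    exact OneOneTwo.pd_radial ((hf.contDiffAt (hs.mem_nhds hy)).differentiableAt (by norm_num)) a
  have h := (HasGrad.radial hd).congr he
  have e0 := h.2 0
  have e1 := h.2 1
  simp only [Matrix.cons_val_zero, Matrix.cons_val_one] at e0 e1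
  rw [e0, e1]
  exact h

/-- Symmetry of the second derivative of a `C²` function. It yields the skew symmetry of the orbit
curvature and the symmetry of the Hessian of `R`. -/
theorem pd_comm_radial {f : ℝ × ℝ → ℝ} {s : Set (ℝ × ℝ)} (hs : IsOpen s)
    (hf : ContDiffOn ℝ 2 f s) {x : Pt} (hx : (x 0, x 1) ∈ s) (a b : Fin 4) :
    pd a (pd b (radial f)) x = pd b (pd a (radial f)) x := by
  have hc : ContDiffAt ℝ 2 (radial f) x :=
    ContDiffAt.comp (g := f) (f := orbitProj) x (hf.contDiffAt (hs.mem_nhds hx))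
      orbitProj.contDiff.contDiffAt
  have hd : DifferentiableAt ℝ (fderiv ℝ (radial f)) x :=
    (hc.fderiv_right (m := 1) (by norm_num)).differentiableAt (by norm_num)
  have h := hc.isSymmSndFDerivAt (by simp) (Pi.single a 1) (Pi.single b 1)
  have key : ∀ c d : Fin 4, pd c (pd d (radial f)) x
      = fderiv ℝ (fderiv ℝ (radial f)) x (Pi.single c 1) (Pi.single d 1) := by
    intro c d
    have e : HasFDerivAt (pd d (radial f)) _ x :=
      hd.hasFDerivAt.clm_apply (hasFDerivAt_const (Pi.single d (1 : ℝ) : Pt) x)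
    rw [pd, e.fderiv]
    simp
  rw [key, key, h]

end OneOneTwo

/-! ### The orbit metric, its connection and the inverse metric. -/

namespace OneOneTwo

noncomputable section

namespace SphericalSpacetime

variable (S : SphericalSpacetime)

/-- Determinant of the metric of the orbit space. -/
def orbitDet (y : Pt) : ℝ := radial S.g00 y * radial S.g11 y - radial S.g01 y * radial S.g01 y

/-- Component `Γ^0_{00}` of the connection of the orbit space. -/
def conn000 (y : Pt) : ℝ :=
  (radial S.g11 y * pd 0 (radial S.g00) y
    - radial S.g01 y * (2 * pd 0 (radial S.g01) y - pd 1 (radial S.g00) y)) / (2 * S.orbitDet y)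

/-- Component `Γ^1_{00}` of the connection of the orbit space. -/
def conn100 (y : Pt) : ℝ :=
  (radial S.g00 y * (2 * pd 0 (radial S.g01) y - pd 1 (radial S.g00) y)
    - radial S.g01 y * pd 0 (radial S.g00) y) / (2 * S.orbitDet y)

/-- Component `Γ^0_{01}` of the connection of the orbit space. -/
def conn001 (y : Pt) : ℝ :=
  (radial S.g11 y * pd 1 (radial S.g00) y - radial S.g01 y * pd 0 (radial S.g11) y)
    / (2 * S.orbitDet y)

/-- Component `Γ^1_{01}` of the connection of the orbit space. -/
def conn101 (y : Pt) : ℝ :=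
  (radial S.g00 y * pd 0 (radial S.g11) y - radial S.g01 y * pd 1 (radial S.g00) y)
    / (2 * S.orbitDet y)

/-- Component `Γ^0_{11}` of the connection of the orbit space. -/
def conn011 (y : Pt) : ℝ :=
  (radial S.g11 y * (2 * pd 1 (radial S.g01) y - pd 0 (radial S.g11) y)
    - radial S.g01 y * pd 1 (radial S.g11) y) / (2 * S.orbitDet y)

/-- Component `Γ^1_{11}` of the connection of the orbit space. -/
def conn111 (y : Pt) : ℝ :=
  (radial S.g00 y * pd 1 (radial S.g11) y
    - radial S.g01 y * (2 * pd 1 (radial S.g01) y - pd 0 (radial S.g11) y)) / (2 * S.orbitDet y)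

/-- Component `∇^0 R` of the gradient of the area radius. -/
def gradR0 (y : Pt) : ℝ :=
  (radial S.g11 y * pd 0 (radial S.R) y - radial S.g01 y * pd 1 (radial S.R) y) / S.orbitDet y

/-- Component `∇^1 R` of the gradient of the area radius. -/
def gradR1 (y : Pt) : ℝ :=
  (radial S.g00 y * pd 1 (radial S.R) y - radial S.g01 y * pd 0 (radial S.R) y) / S.orbitDet y

/-- Squares become products so that the product rule `HasGrad.mul` applies entrywise. -/
theorem metric_eq (y : Pt) : S.metric y =
    !![radial S.g00 y, radial S.g01 y, 0, 0;
       radial S.g01 y, radial S.g11 y, 0, 0;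
       0, 0, radial S.R y * radial S.R y, 0;
       0, 0, 0, radial S.R y * radial S.R y * (Real.sin (y 2) * Real.sin (y 2))] := by
  simp only [metric, radial, sq]

variable {S} {x : Pt}

theorem isOpen_domain : IsOpen S.domain := by
  have h1 : IsOpen (orbitProj ⁻¹' S.base) := S.isOpen_base.preimage orbitProj.continuous
  have h2 : IsOpen {y : Pt | 0 < y 2 ∧ y 2 < Real.pi} :=
    (isOpen_lt continuous_const (continuous_apply 2)).inter
      (isOpen_lt (continuous_apply 2) continuous_const)
  exact h1.inter h2

theorem orbitDet_neg (hx : x ∈ S.domain) : S.orbitDet x < 0 := by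
  have := S.lorentzian _ hx.1
  simp only [orbitDet, radial]
  linarith

theorem radial_R_pos (hx : x ∈ S.domain) : 0 < radial S.R x := S.R_pos _ hx.1

theorem sin_pos (hx : x ∈ S.domain) : 0 < Real.sin (x 2) :=
  Real.sin_pos_of_pos_of_lt_pi hx.2.1 hx.2.2

theorem hasGrad_coeff {f : ℝ × ℝ → ℝ} (hf : ContDiffOn ℝ 2 f S.base) (hx : x ∈ S.domain) :
    HasGrad (radial f) ![pd 0 (radial f) x, pd 1 (radial f) x, 0, 0] x :=
  HasGrad.radial
    ((hf.contDiffAt (S.isOpen_base.mem_nhds hx.1)).differentiableAt (by norm_num))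

theorem inv_metric (hx : x ∈ S.domain) : inv S.metric x =
    !![radial S.g11 x / S.orbitDet x, -radial S.g01 x / S.orbitDet x, 0, 0;
       -radial S.g01 x / S.orbitDet x, radial S.g00 x / S.orbitDet x, 0, 0;
       0, 0, 1 / (radial S.R x * radial S.R x), 0;
       0, 0, 0, 1 / (radial S.R x * radial S.R x * (Real.sin (x 2) * Real.sin (x 2)))] := by
  have hd := (orbitDet_neg hx).ne
  have hr := (radial_R_pos hx).ne'
  have hs := (sin_pos hx).ne'
  refine Matrix.inv_eq_right_inv ?_
  rw [metric_eq]
  ext i j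
  fin_cases i <;> fin_cases j <;>
    -- The determinant stays opaque while denominators are cleared, so that its nonvanishing can be
    -- used, and is expanded only afterwards.
    simp [Matrix.mul_apply, Fin.sum_univ_four] <;> field_simp <;>
    simp only [orbitDet] <;> ring


end SphericalSpacetime

end

end OneOneTwo

/-! ### Christoffel symbols. -/

namespace OneOneTwo

noncomputable section

namespace SphericalSpacetime

variable {S : SphericalSpacetime} {x : Pt}

/-- The gradients of the metric components. -/
theorem hasGrad_metric (hx : x ∈ S.domain) (i j : Fin 4) :
    HasGrad (fun y => S.metric y i j)
      (!![![pd 0 (radial S.g00) x, pd 1 (radial S.g00) x, 0, 0],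
            ![pd 0 (radial S.g01) x, pd 1 (radial S.g01) x, 0, 0], 0, 0;
          ![pd 0 (radial S.g01) x, pd 1 (radial S.g01) x, 0, 0],
            ![pd 0 (radial S.g11) x, pd 1 (radial S.g11) x, 0, 0], 0, 0;
          0, 0, ![2 * radial S.R x * pd 0 (radial S.R) x,
            2 * radial S.R x * pd 1 (radial S.R) x, 0, 0], 0;
          0, 0, 0, ![2 * radial S.R x * pd 0 (radial S.R) x * (Real.sin (x 2) * Real.sin (x 2)),
            2 * radial S.R x * pd 1 (radial S.R) x * (Real.sin (x 2) * Real.sin (x 2)),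
            2 * (radial S.R x * radial S.R x) * (Real.sin (x 2) * Real.cos (x 2)), 0]] i j) x := by
  have h0 : HasGrad (fun _ : Pt => (0 : ℝ)) 0 x := HasGrad.const 0
  have ha := hasGrad_coeff S.contDiffOn_g00 hx
  have hb := hasGrad_coeff S.contDiffOn_g01 hx
  have hc := hasGrad_coeff S.contDiffOn_g11 hx
  have hr := hasGrad_coeff S.contDiffOn_R hx
  have hs : HasGrad (fun y => Real.sin (y 2)) _ x := HasGrad.sin_two
  simp only [metric_eq]
  fin_cases i <;> fin_cases j
  · exact ha
  · exact hb
  · exact h0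
  · exact h0
  · exact hb
  · exact hc
  iterate 4 exact h0
  · refine (hr.mul hr).congr_grad fun k => ?_
    fin_cases k <;> simp
    all_goals ring
  iterate 4 exact h0
  · refine ((hr.mul hr).mul (hs.mul hs)).congr_grad fun k => ?_
    fin_cases k <;> simp [-mul_eq_mul_right_iff, -mul_eq_mul_left_iff]
    all_goals ring

theorem pd_metric (hx : x ∈ S.domain) :
    (∀ i j, pd 0 (fun y => S.metric y i j) x =
      !![pd 0 (radial S.g00) x, pd 0 (radial S.g01) x, 0, 0;
         pd 0 (radial S.g01) x, pd 0 (radial S.g11) x, 0, 0;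
         0, 0, 2 * radial S.R x * pd 0 (radial S.R) x, 0;
         0, 0, 0, 2 * radial S.R x * pd 0 (radial S.R) x *
           (Real.sin (x 2) * Real.sin (x 2))] i j) ∧
    (∀ i j, pd 1 (fun y => S.metric y i j) x =
      !![pd 1 (radial S.g00) x, pd 1 (radial S.g01) x, 0, 0;
         pd 1 (radial S.g01) x, pd 1 (radial S.g11) x, 0, 0;
         0, 0, 2 * radial S.R x * pd 1 (radial S.R) x, 0;
         0, 0, 0, 2 * radial S.R x * pd 1 (radial S.R) x *
           (Real.sin (x 2) * Real.sin (x 2))] i j) ∧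
    (∀ i j, pd 2 (fun y => S.metric y i j) x =
      !![0, 0, 0, 0; 0, 0, 0, 0; 0, 0, 0, 0;
         0, 0, 0, 2 * (radial S.R x * radial S.R x) *
           (Real.sin (x 2) * Real.cos (x 2))] i j) ∧
    ∀ i j, pd 3 (fun y => S.metric y i j) x = 0 := by
  refine ⟨fun i j => ?_, fun i j => ?_, fun i j => ?_, fun i j => ?_⟩ <;>
    refine ((hasGrad_metric hx i j).pd_eq _).trans ?_ <;>
    fin_cases i <;> fin_cases j <;> rfl

/-- The inverse metric is block diagonal, so only `d = 0, 1` contribute. The angular entries come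
from `-½ g^{0d} ∂_d R²`, which is `-R ∇^0 R`. -/
theorem christoffel_zero (hx : x ∈ S.domain) (b c : Fin 4) :
    christoffel S.metric 0 b c x =
      !![S.conn000 x, S.conn001 x, 0, 0;
         S.conn001 x, S.conn011 x, 0, 0;
         0, 0, -(radial S.R x * S.gradR0 x), 0;
         0, 0, 0, -(radial S.R x * S.gradR0 x * (Real.sin (x 2) * Real.sin (x 2)))] b c := by
  have hd := (orbitDet_neg hx).ne
  obtain ⟨h0, h1, h2, h3⟩ := pd_metric hx
  have e : ∀ d, inv S.metric x 0 d =
      ![radial S.g11 x / S.orbitDet x, -radial S.g01 x / S.orbitDet x, 0, 0] d := by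
    rw [inv_metric hx]; exact fun _ => rfl
  simp only [christoffel, Fin.sum_univ_four, e]
  fin_cases b <;> fin_cases c <;> simp [h0, h1, h2, h3, conn000, conn001, conn011, gradR0] <;>
    field_simp <;> ring

theorem christoffel_one (hx : x ∈ S.domain) (b c : Fin 4) :
    christoffel S.metric 1 b c x =
      !![S.conn100 x, S.conn101 x, 0, 0;
         S.conn101 x, S.conn111 x, 0, 0;
         0, 0, -(radial S.R x * S.gradR1 x), 0;
         0, 0, 0, -(radial S.R x * S.gradR1 x * (Real.sin (x 2) * Real.sin (x 2)))] b c := by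
  have hd := (orbitDet_neg hx).ne
  obtain ⟨h0, h1, h2, h3⟩ := pd_metric hx
  have e : ∀ d, inv S.metric x 1 d =
      ![-radial S.g01 x / S.orbitDet x, radial S.g00 x / S.orbitDet x, 0, 0] d := by
    rw [inv_metric hx]; exact fun _ => rfl
  simp only [christoffel, Fin.sum_univ_four, e]
  fin_cases b <;> fin_cases c <;> simp [h0, h1, h2, h3, conn100, conn101, conn111, gradR1] <;>
    field_simp <;> ring

theorem christoffel_two (hx : x ∈ S.domain) (b c : Fin 4) :
    christoffel S.metric 2 b c x =
      !![0, 0, pd 0 (radial S.R) x / radial S.R x, 0;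
         0, 0, pd 1 (radial S.R) x / radial S.R x, 0;
         pd 0 (radial S.R) x / radial S.R x, pd 1 (radial S.R) x / radial S.R x, 0, 0;
         0, 0, 0, -(Real.sin (x 2) * Real.cos (x 2))] b c := by
  have hr := (radial_R_pos hx).ne'
  obtain ⟨h0, h1, h2, h3⟩ := pd_metric hx
  have e : ∀ d, inv S.metric x 2 d = ![0, 0, 1 / (radial S.R x * radial S.R x), 0] d := by
    rw [inv_metric hx]; exact fun _ => rfl
  simp only [christoffel, Fin.sum_univ_four, e]
  fin_cases b <;> fin_cases c <;> simp [h0, h1, h2, h3] <;> field_simp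

theorem christoffel_three (hx : x ∈ S.domain) (b c : Fin 4) :
    christoffel S.metric 3 b c x =
      !![0, 0, 0, pd 0 (radial S.R) x / radial S.R x;
         0, 0, 0, pd 1 (radial S.R) x / radial S.R x;
         0, 0, 0, Real.cos (x 2) / Real.sin (x 2);
         pd 0 (radial S.R) x / radial S.R x, pd 1 (radial S.R) x / radial S.R x,
           Real.cos (x 2) / Real.sin (x 2), 0] b c := by
  have hr := (radial_R_pos hx).ne'
  have hs := (sin_pos hx).ne'
  obtain ⟨h0, h1, h2, h3⟩ := pd_metric hx
  have e : ∀ d, inv S.metric x 3 d = ![0, 0, 0,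
      1 / (radial S.R x * radial S.R x * (Real.sin (x 2) * Real.sin (x 2)))] d := by
    rw [inv_metric hx]; exact fun _ => rfl
  simp only [christoffel, Fin.sum_univ_four, e]
  fin_cases b <;> fin_cases c <;> simp [h0, h1, h2, h3] <;> field_simp

end SphericalSpacetime

end

end OneOneTwo

/-! ### Curvature of the orbit space. -/

namespace OneOneTwo

noncomputable section

namespace SphericalSpacetime

variable {S : SphericalSpacetime} {x : Pt}

/-- Metric compatibility of the connection of the orbit space. -/
theorem pd_coeff_eq (hx : x ∈ S.domain) :
    pd 0 (radial S.g00) x = 2 * (radial S.g00 x * S.conn000 x + radial S.g01 x * S.conn100 x) ∧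
    pd 1 (radial S.g00) x = 2 * (radial S.g00 x * S.conn001 x + radial S.g01 x * S.conn101 x) ∧
    pd 0 (radial S.g01) x = radial S.g00 x * S.conn001 x + radial S.g01 x * S.conn101 x
      + (radial S.g01 x * S.conn000 x + radial S.g11 x * S.conn100 x) ∧
    pd 1 (radial S.g01) x = radial S.g00 x * S.conn011 x + radial S.g01 x * S.conn111 x
      + (radial S.g01 x * S.conn001 x + radial S.g11 x * S.conn101 x) ∧
    pd 0 (radial S.g11) x = 2 * (radial S.g01 x * S.conn001 x + radial S.g11 x * S.conn101 x) ∧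
    pd 1 (radial S.g11) x = 2 * (radial S.g01 x * S.conn011 x + radial S.g11 x * S.conn111 x) := by
  have hd := (orbitDet_neg hx).ne
  simp only [conn000, conn001, conn011, conn100, conn101, conn111]
  refine ⟨?_, ?_, ?_, ?_, ?_, ?_⟩ <;> field_simp <;> simp only [orbitDet] <;> ring

/-- Lowers the index of the gradient, putting `∂_A R` in the form that `pd_lower` differentiates. -/
theorem pd_R_eq (hx : x ∈ S.domain) :
    pd 0 (radial S.R) x = radial S.g00 x * S.gradR0 x + radial S.g01 x * S.gradR1 x ∧
    pd 1 (radial S.R) x = radial S.g01 x * S.gradR0 x + radial S.g11 x * S.gradR1 x := by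
  have hd := (orbitDet_neg hx).ne
  simp only [gradR0, gradR1]
  refine ⟨?_, ?_⟩ <;> field_simp <;> simp only [orbitDet] <;> ring

theorem hasGrad_pd_coeff {f : ℝ × ℝ → ℝ} (hf : ContDiffOn ℝ 2 f S.base) (hx : x ∈ S.domain)
    (a : Fin 4) : HasGrad (pd a (radial f)) (fun b => pd b (pd a (radial f)) x) x :=
  .of_differentiableAt (HasGrad.pd_radial S.isOpen_base hf hx.1 a).1

/-- The factor `r` covers both denominators: `2 det` for the connection and `det` for the gradient
of `R`. -/
theorem differentiableAt_quotient {f : Pt → ℝ} (hf : DifferentiableAt ℝ f x) (hx : x ∈ S.domain)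
    (r : ℝ) (hr : r ≠ 0) : DifferentiableAt ℝ (fun y => f y / (r * S.orbitDet y)) x := by
  have ha := hasGrad_coeff S.contDiffOn_g00 hx
  have hb := hasGrad_coeff S.contDiffOn_g01 hx
  have hc := hasGrad_coeff S.contDiffOn_g11 hx
  have hd : HasGrad S.orbitDet _ x := (ha.mul hc).sub (hb.mul hb)
  exact ((HasGrad.of_differentiableAt hf).div ((HasGrad.const r).mul hd)
    (mul_ne_zero hr (orbitDet_neg hx).ne)).1

/-- Only differentiability is recorded; the derivatives remain the symbols `pd k _ x`, since no
explicit formula for them is needed. -/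
theorem hasGrad_conn (hx : x ∈ S.domain) :
    HasGrad S.conn000 (fun k => pd k S.conn000 x) x ∧
    HasGrad S.conn001 (fun k => pd k S.conn001 x) x ∧
    HasGrad S.conn011 (fun k => pd k S.conn011 x) x ∧
    HasGrad S.conn100 (fun k => pd k S.conn100 x) x ∧
    HasGrad S.conn101 (fun k => pd k S.conn101 x) x ∧
    HasGrad S.conn111 (fun k => pd k S.conn111 x) x := by
  have ha := (hasGrad_coeff S.contDiffOn_g00 hx).1
  have hb := (hasGrad_coeff S.contDiffOn_g01 hx).1
  have hc := (hasGrad_coeff S.contDiffOn_g11 hx).1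
  have ha' := fun k => (hasGrad_pd_coeff S.contDiffOn_g00 hx k).1
  have hb' := fun k => (hasGrad_pd_coeff S.contDiffOn_g01 hx k).1
  have hc' := fun k => (hasGrad_pd_coeff S.contDiffOn_g11 hx k).1
  refine ⟨?_, ?_, ?_, ?_, ?_, ?_⟩ <;>
    refine .of_differentiableAt (differentiableAt_quotient ?_ hx 2 two_ne_zero) <;> fun_prop

theorem hasGrad_gradR (hx : x ∈ S.domain) :
    HasGrad S.gradR0 (fun k => pd k S.gradR0 x) x ∧
    HasGrad S.gradR1 (fun k => pd k S.gradR1 x) x := by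
  have ha := (hasGrad_coeff S.contDiffOn_g00 hx).1
  have hb := (hasGrad_coeff S.contDiffOn_g01 hx).1
  have hc := (hasGrad_coeff S.contDiffOn_g11 hx).1
  have hr := fun k => (hasGrad_pd_coeff S.contDiffOn_R hx k).1
  refine ⟨.of_differentiableAt ?_, .of_differentiableAt ?_⟩
  · have := differentiableAt_quotient (S := S) (x := x) (f := fun y =>
      radial S.g11 y * pd 0 (radial S.R) y - radial S.g01 y * pd 1 (radial S.R) y)
      (by fun_prop) hx 1 one_ne_zero
    simp only [one_mul] at this
    exact this
  · have := differentiableAt_quotient (S := S) (x := x) (f := fun y =>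
      radial S.g00 y * pd 1 (radial S.R) y - radial S.g01 y * pd 0 (radial S.R) y)
      (by fun_prop) hx 1 one_ne_zero
    simp only [one_mul] at this
    exact this

/-- Two functions that agree on the coordinate domain have the same partial derivatives there. -/
theorem pd_congr {f h : Pt → ℝ} (hfh : ∀ y ∈ S.domain, f y = h y) (hx : x ∈ S.domain)
    (k : Fin 4) : pd k f x = pd k h x := by
  have he : f =ᶠ[nhds x] h := by
    filter_upwards [isOpen_domain.mem_nhds hx] with y hy using hfh y hy
  rw [pd, pd, he.fderiv_eq]

/-- Derivative of a contraction with the metric coefficients. -/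
theorem pd_lower {f p q : Pt → ℝ} {a b : ℝ × ℝ → ℝ} (ha : ContDiffOn ℝ 2 a S.base)
    (hb : ContDiffOn ℝ 2 b S.base) (hp : HasGrad p (fun k => pd k p x) x)
    (hq : HasGrad q (fun k => pd k q x) x) (hx : x ∈ S.domain)
    (hf : ∀ y ∈ S.domain, f y = radial a y * p y + radial b y * q y) (k : Fin 4) :
    pd k f x = pd k (radial a) x * p x + radial a x * pd k p x
      + (pd k (radial b) x * q x + radial b x * pd k q x) := by
  have ha := HasGrad.of_differentiableAt (hasGrad_coeff ha hx).1
  have hb := HasGrad.of_differentiableAt (hasGrad_coeff hb hx).1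
  rw [pd_congr hf hx k]
  exact ((ha.mul hp).add (hb.mul hq)).pd_eq k

theorem riemannUp_swap (g : Tensor2) (a b c d : Fin 4) (x : Pt) :
    riemannUp g a b d c x = -riemannUp g a b c d x := by
  simp only [riemannUp, Fin.sum_univ_four]
  ring

theorem riemannUp_self (g : Tensor2) (a b c : Fin 4) (x : Pt) : riemannUp g a b c c x = 0 := by
  have := riemannUp_swap g a b c c x
  linarith

/-- The closed form holds on an open set, so it may be differentiated in place of the definition. -/
theorem pd_christoffel_zero (hx : x ∈ S.domain) (k b c : Fin 4) :
    pd k (christoffel S.metric 0 b c) x = pd k (fun y =>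
      !![S.conn000 y, S.conn001 y, 0, 0;
         S.conn001 y, S.conn011 y, 0, 0;
         0, 0, -(radial S.R y * S.gradR0 y), 0;
         0, 0, 0, -(radial S.R y * S.gradR0 y * (Real.sin (y 2) * Real.sin (y 2)))] b c) x :=
  pd_congr (fun _ hy => christoffel_zero hy b c) hx k

theorem pd_christoffel_one (hx : x ∈ S.domain) (k b c : Fin 4) :
    pd k (christoffel S.metric 1 b c) x = pd k (fun y =>
      !![S.conn100 y, S.conn101 y, 0, 0;
         S.conn101 y, S.conn111 y, 0, 0;
         0, 0, -(radial S.R y * S.gradR1 y), 0;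
         0, 0, 0, -(radial S.R y * S.gradR1 y * (Real.sin (y 2) * Real.sin (y 2)))] b c) x :=
  pd_congr (fun _ hy => christoffel_one hy b c) hx k

theorem pd_christoffel_two (hx : x ∈ S.domain) (k b c : Fin 4) :
    pd k (christoffel S.metric 2 b c) x = pd k (fun y =>
      !![0, 0, pd 0 (radial S.R) y / radial S.R y, 0;
         0, 0, pd 1 (radial S.R) y / radial S.R y, 0;
         pd 0 (radial S.R) y / radial S.R y, pd 1 (radial S.R) y / radial S.R y, 0, 0;
         0, 0, 0, -(Real.sin (y 2) * Real.cos (y 2))] b c) x :=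
  pd_congr (fun _ hy => christoffel_two hy b c) hx k

theorem pd_christoffel_three (hx : x ∈ S.domain) (k b c : Fin 4) :
    pd k (christoffel S.metric 3 b c) x = pd k (fun y =>
      !![0, 0, 0, pd 0 (radial S.R) y / radial S.R y;
         0, 0, 0, pd 1 (radial S.R) y / radial S.R y;
         0, 0, 0, Real.cos (y 2) / Real.sin (y 2);
         pd 0 (radial S.R) y / radial S.R y, pd 1 (radial S.R) y / radial S.R y,
           Real.cos (y 2) / Real.sin (y 2), 0] b c) x :=
  pd_congr (fun _ hy => christoffel_three hy b c) hx k

/-- Components `R^A_{B01}` of the curvature. -/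
theorem riemannUp_orbit (hx : x ∈ S.domain) :
    riemannUp S.metric 0 0 0 1 x = pd 0 S.conn001 x - pd 1 S.conn000 x
      + (S.conn001 x * S.conn101 x - S.conn011 x * S.conn100 x) ∧
    riemannUp S.metric 0 1 0 1 x = pd 0 S.conn011 x - pd 1 S.conn001 x
      + (S.conn000 x * S.conn011 x + S.conn001 x * S.conn111 x
        - S.conn001 x * S.conn001 x - S.conn011 x * S.conn101 x) ∧
    riemannUp S.metric 1 0 0 1 x = pd 0 S.conn101 x - pd 1 S.conn100 x
      + (S.conn100 x * S.conn001 x + S.conn101 x * S.conn101 x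
        - S.conn101 x * S.conn000 x - S.conn111 x * S.conn100 x) ∧
    riemannUp S.metric 1 1 0 1 x = pd 0 S.conn111 x - pd 1 S.conn101 x
      + (S.conn100 x * S.conn011 x - S.conn101 x * S.conn001 x) := by
  simp only [riemannUp, Fin.sum_univ_four, pd_christoffel_zero hx, pd_christoffel_one hx,
    christoffel_zero hx, christoffel_one hx, christoffel_two hx, christoffel_three hx]
  refine ⟨?_, ?_, ?_, ?_⟩ <;> simp <;> ring

/-- Gaussian curvature of the orbit space. -/
def gaussCurv (S : SphericalSpacetime) (x : Pt) : ℝ :=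
  (radial S.g00 x * riemannUp S.metric 0 1 0 1 x + radial S.g01 x * riemannUp S.metric 1 1 0 1 x)
    / S.orbitDet x

/-- These say `R_{AB01} + R_{BA01} = 0`. Differentiating the compatibility relations for `∂_0 g` and
`∂_1 g` crosswise and equating the mixed second partials of `g_{AB}` gives exactly this. -/
theorem riemannUp_orbit_skew (hx : x ∈ S.domain) :
    radial S.g00 x * riemannUp S.metric 0 0 0 1 x
      + radial S.g01 x * riemannUp S.metric 1 0 0 1 x = 0 ∧
    radial S.g01 x * riemannUp S.metric 0 1 0 1 x
      + radial S.g11 x * riemannUp S.metric 1 1 0 1 x = 0 ∧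
    radial S.g00 x * riemannUp S.metric 0 1 0 1 x + radial S.g01 x * riemannUp S.metric 1 1 0 1 x
      + (radial S.g01 x * riemannUp S.metric 0 0 0 1 x
        + radial S.g11 x * riemannUp S.metric 1 0 0 1 x) = 0 := by
  obtain ⟨h1, h2, h3, h4⟩ := riemannUp_orbit hx
  rw [h1, h2, h3, h4]
  obtain ⟨k000, k001, k011, k100, k101, k111⟩ := hasGrad_conn hx
  have ca := pd_comm_radial S.isOpen_base S.contDiffOn_g00 hx.1 0 1
  have cb := pd_comm_radial S.isOpen_base S.contDiffOn_g01 hx.1 0 1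
  have cc := pd_comm_radial S.isOpen_base S.contDiffOn_g11 hx.1 0 1
  -- For `g_00` and `g_11` the two terms of the compatibility relation coincide, whence a factor 2
  -- to divide out.
  have half {f p : Pt → ℝ} (hp : HasGrad p (fun k => pd k p x) x)
      (h : ∀ y ∈ S.domain, p y = 2 * f y) (k : Fin 4) : pd k p x = 2 * pd k f x := by
    have hf : ∀ y ∈ S.domain, f y = 1 / 2 * p y := fun y hy => by rw [h y hy]; ring
    rw [pd_congr hf hx, (((HasGrad.const (1 / 2)).mul hp)).pd_eq k]
    ring
  have pa := hasGrad_pd_coeff S.contDiffOn_g00 hx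
  have pc := hasGrad_pd_coeff S.contDiffOn_g11 hx
  have a0 := half (pa 0) (fun y hy => (pd_coeff_eq hy).1) 1
  have a1 := half (pa 1) (fun y hy => (pd_coeff_eq hy).2.1) 0
  have c0 := half (pc 0) (fun y hy => (pd_coeff_eq hy).2.2.2.2.1) 1
  have c1 := half (pc 1) (fun y hy => (pd_coeff_eq hy).2.2.2.2.2) 0
  have l {p q : Pt → ℝ} {a b : ℝ × ℝ → ℝ} (ha : ContDiffOn ℝ 2 a S.base)
      (hb : ContDiffOn ℝ 2 b S.base) (hp : HasGrad p (fun k => pd k p x) x)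
      (hq : HasGrad q (fun k => pd k q x) x) :=
    pd_lower ha hb hp hq hx (fun y _ => rfl)
  have d {p q p' q' : Pt → ℝ} (hp : HasGrad p (fun k => pd k p x) x)
      (hq : HasGrad q (fun k => pd k q x) x) (hp' : HasGrad p' (fun k => pd k p' x) x)
      (hq' : HasGrad q' (fun k => pd k q' x) x) :=
    (HasGrad.of_differentiableAt (((hasGrad_coeff S.contDiffOn_g00 hx).mul hp).add
      ((hasGrad_coeff S.contDiffOn_g01 hx).mul hq)).1).add
    (HasGrad.of_differentiableAt (((hasGrad_coeff S.contDiffOn_g01 hx).mul hp').add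
      ((hasGrad_coeff S.contDiffOn_g11 hx).mul hq')).1)
  have b0 := (d k001 k101 k000 k100).pd_eq 1
  rw [← pd_congr (fun y hy => (pd_coeff_eq hy).2.2.1) hx] at b0
  have b1 := (d k011 k111 k001 k101).pd_eq 0
  rw [← pd_congr (fun y hy => (pd_coeff_eq hy).2.2.2.1) hx] at b1
  rw [l S.contDiffOn_g00 S.contDiffOn_g01 k000 k100] at a0
  rw [l S.contDiffOn_g00 S.contDiffOn_g01 k001 k101] at a1
  rw [l S.contDiffOn_g01 S.contDiffOn_g11 k001 k101] at c0
  rw [l S.contDiffOn_g01 S.contDiffOn_g11 k011 k111] at c1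
  rw [l S.contDiffOn_g00 S.contDiffOn_g01 k001 k101,
    l S.contDiffOn_g01 S.contDiffOn_g11 k000 k100] at b0
  rw [l S.contDiffOn_g00 S.contDiffOn_g01 k011 k111,
    l S.contDiffOn_g01 S.contDiffOn_g11 k001 k101] at b1
  obtain ⟨e1, e2, e3, e4, e5, e6⟩ := pd_coeff_eq hx
  simp only [e1, e2, e3, e4, e5, e6] at a0 a1 b0 b1 c0 c1
  refine ⟨?_, ?_, ?_⟩
  -- Each goal is the equality of mixed partials with both sides expanded; on the diagonal it is
  -- twice the curvature component.
  · linear_combination (ca - a1 + a0) / 2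
  · linear_combination (cc - c1 + c0) / 2
  · linear_combination cb - b1 + b0

/-- The curvature of the orbit space is determined by the Gaussian curvature. -/
theorem riemannUp_gaussCurv (hx : x ∈ S.domain) :
    riemannUp S.metric 0 0 0 1 x = S.gaussCurv x * radial S.g01 x ∧
    riemannUp S.metric 0 1 0 1 x = S.gaussCurv x * radial S.g11 x ∧
    riemannUp S.metric 1 0 0 1 x = -(S.gaussCurv x * radial S.g00 x) ∧
    riemannUp S.metric 1 1 0 1 x = -(S.gaussCurv x * radial S.g01 x) := by
  have hd := (orbitDet_neg hx).ne
  obtain ⟨h1, h2, h3⟩ := riemannUp_orbit_skew hx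
  simp only [gaussCurv]
  -- By skewness `R_{0001} = R_{1101} = 0` and `R_{0101} = -R_{1001} = K det`; the cofactors of the
  -- orbit metric raise the first index.
  refine ⟨?_, ?_, ?_, ?_⟩ <;> field_simp <;> simp only [orbitDet]
  · linear_combination radial S.g11 x * h1 - radial S.g01 x * h3
  · linear_combination -radial S.g01 x * h2
  · linear_combination -radial S.g01 x * h1 + radial S.g00 x * h3
  · linear_combination radial S.g00 x * h2

end SphericalSpacetime

end

end OneOneTwo

/-! ### Hessian of the area radius and Ricci curvature. -/

namespace OneOneTwo

noncomputable section

namespace SphericalSpacetime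

variable (S : SphericalSpacetime)

/-- Component `∇_0 ∇_0 R` of the Hessian of the area radius. -/
def hess00 (x : Pt) : ℝ := pd 0 (pd 0 (radial S.R)) x
  - (S.conn000 x * pd 0 (radial S.R) x + S.conn100 x * pd 1 (radial S.R) x)

/-- Component `∇_0 ∇_1 R` of the Hessian of the area radius. -/
def hess01 (x : Pt) : ℝ := pd 0 (pd 1 (radial S.R)) x
  - (S.conn001 x * pd 0 (radial S.R) x + S.conn101 x * pd 1 (radial S.R) x)

/-- Component `∇_1 ∇_1 R` of the Hessian of the area radius. -/
def hess11 (x : Pt) : ℝ := pd 1 (pd 1 (radial S.R)) x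
  - (S.conn011 x * pd 0 (radial S.R) x + S.conn111 x * pd 1 (radial S.R) x)

/-- The d'Alembertian of the area radius on the orbit space. -/
def boxR (x : Pt) : ℝ := pd 0 S.gradR0 x + pd 1 S.gradR1 x
  + ((S.conn000 x + S.conn101 x) * S.gradR0 x + (S.conn001 x + S.conn111 x) * S.gradR1 x)

variable {S} {x : Pt}

theorem gradSq_radius (hx : x ∈ S.domain) : gradSq S.metric S.radius x =
    pd 0 (radial S.R) x * S.gradR0 x + pd 1 (radial S.R) x * S.gradR1 x := by
  have h : ∀ k, pd k S.radius x = ![pd 0 (radial S.R) x, pd 1 (radial S.R) x, 0, 0] k :=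
    (hasGrad_coeff S.contDiffOn_R hx).pd_eq
  simp [gradSq, Fin.sum_univ_four, h, inv_metric hx, gradR0, gradR1]
  ring

/-- The divergence of the gradient is the trace of the Hessian, by metric compatibility. The
divergence appears in the angular Ricci components, the Hessian in the orbit ones, and this lets
them be compared. -/
theorem orbitDet_mul_boxR (hx : x ∈ S.domain) : S.orbitDet x * S.boxR x =
    radial S.g11 x * S.hess00 x - 2 * radial S.g01 x * S.hess01 x + radial S.g00 x * S.hess11 x := by
  obtain ⟨v0, v1⟩ := hasGrad_gradR hx
  have r0 := pd_lower S.contDiffOn_g00 S.contDiffOn_g01 v0 v1 hx (fun y hy => (pd_R_eq hy).1)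
  have r1 := pd_lower S.contDiffOn_g01 S.contDiffOn_g11 v0 v1 hx (fun y hy => (pd_R_eq hy).2)
  have hc := pd_comm_radial S.isOpen_base S.contDiffOn_R hx.1 0 1
  have h00 := r0 0
  have h10 := r0 1
  have h01 := r1 0
  have h11 := r1 1
  obtain ⟨e1, e2, e3, e4, e5, e6⟩ := pd_coeff_eq hx
  obtain ⟨d0, d1⟩ := pd_R_eq hx
  simp only [e1, e2, e3, e4, e5, e6] at h00 h10 h01 h11
  simp only [hess00, hess01, hess11, boxR, orbitDet, d0, d1]
  linear_combination -radial S.g11 x * h00 + radial S.g01 x * h01 + radial S.g01 x * h10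
    + radial S.g01 x * hc - radial S.g00 x * h11

theorem hasGrad_log_R (hx : x ∈ S.domain) (a : Fin 4) :
    HasGrad (fun y => pd a (radial S.R) y / radial S.R y)
      (fun k => (pd k (pd a (radial S.R)) x * radial S.R x
        - pd a (radial S.R) x * pd k (radial S.R) x) / radial S.R x ^ 2) x :=
  (hasGrad_pd_coeff S.contDiffOn_R hx a).div
    (HasGrad.of_differentiableAt (hasGrad_coeff S.contDiffOn_R hx).1) (radial_R_pos hx).ne'

/-- Warped-product formula: in `-∂_B(∂_A R / R) - (∂_A R)(∂_B R)/R²` the quadratic terms cancel, and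
the remaining connection terms complete the Hessian. -/
theorem riemannUp_two_orbit (hx : x ∈ S.domain) :
    riemannUp S.metric 2 0 2 0 x = -(S.hess00 x / radial S.R x) ∧
    riemannUp S.metric 2 0 2 1 x = -(S.hess01 x / radial S.R x) ∧
    riemannUp S.metric 2 1 2 0 x = -(S.hess01 x / radial S.R x) ∧
    riemannUp S.metric 2 1 2 1 x = -(S.hess11 x / radial S.R x) := by
  have hr := (radial_R_pos hx).ne'
  have l0 := (hasGrad_log_R hx 0).pd_eq
  have l1 := (hasGrad_log_R hx 1).pd_eq
  have h0 : ∀ k, pd k (fun _ => (0 : ℝ)) x = 0 := fun k => (HasGrad.const 0).pd_eq k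
  have hc := pd_comm_radial S.isOpen_base S.contDiffOn_R hx.1 0 1
  simp only [riemannUp, Fin.sum_univ_four, pd_christoffel_two hx,
    christoffel_zero hx, christoffel_one hx, christoffel_two hx, christoffel_three hx]
  refine ⟨?_, ?_, ?_, ?_⟩ <;> simp [l0, l1, h0, hess00, hess01, hess11, hc] <;>
    field_simp <;> ring

theorem riemannUp_three_orbit (hx : x ∈ S.domain) :
    riemannUp S.metric 3 0 3 0 x = -(S.hess00 x / radial S.R x) ∧
    riemannUp S.metric 3 0 3 1 x = -(S.hess01 x / radial S.R x) ∧
    riemannUp S.metric 3 1 3 0 x = -(S.hess01 x / radial S.R x) ∧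
    riemannUp S.metric 3 1 3 1 x = -(S.hess11 x / radial S.R x) := by
  have hr := (radial_R_pos hx).ne'
  have l0 := (hasGrad_log_R hx 0).pd_eq
  have l1 := (hasGrad_log_R hx 1).pd_eq
  have h0 : ∀ k, pd k (fun _ => (0 : ℝ)) x = 0 := fun k => (HasGrad.const 0).pd_eq k
  have hc := pd_comm_radial S.isOpen_base S.contDiffOn_R hx.1 0 1
  simp only [riemannUp, Fin.sum_univ_four, pd_christoffel_three hx,
    christoffel_zero hx, christoffel_one hx, christoffel_two hx, christoffel_three hx]
  refine ⟨?_, ?_, ?_, ?_⟩ <;> simp [l0, l1, h0, hess00, hess01, hess11, hc] <;>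
    field_simp <;> ring

/-- The `1` is the curvature of the unit sphere, from `-∂_θ cot θ - cot² θ`; the other terms come
from the warping. -/
theorem ricci_two_two (hx : x ∈ S.domain) : ricci S.metric 2 2 x =
    1 - gradSq S.metric S.radius x - radial S.R x * S.boxR x := by
  have hr := (radial_R_pos hx).ne'
  have hs := (sin_pos hx).ne'
  obtain ⟨v0, v1⟩ := hasGrad_gradR hx
  have gr := HasGrad.of_differentiableAt (hasGrad_coeff S.contDiffOn_R hx).1
  have l0 := (gr.mul v0).neg.pd_eq
  have l1 := (gr.mul v1).neg.pd_eq
  have cot := ((HasGrad.cos_two (x := x)).div HasGrad.sin_two hs).pd_eq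
  have h0 : ∀ k, pd k (fun _ => (0 : ℝ)) x = 0 := fun k => (HasGrad.const 0).pd_eq k
  rw [gradSq_radius hx]
  simp only [ricci, Fin.sum_univ_four, riemannUp_self]
  simp only [riemannUp, Fin.sum_univ_four, pd_christoffel_three hx, pd_christoffel_zero hx,
    pd_christoffel_one hx, christoffel_zero hx, christoffel_one hx, christoffel_two hx,
    christoffel_three hx]
  simp [l0, l1, h0, cot, boxR]
  field_simp
  ring

theorem ricci_three_three (hx : x ∈ S.domain) : ricci S.metric 3 3 x =
    (1 - gradSq S.metric S.radius x - radial S.R x * S.boxR x) *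
      (Real.sin (x 2) * Real.sin (x 2)) := by
  have hr := (radial_R_pos hx).ne'
  have hs := (sin_pos hx).ne'
  obtain ⟨v0, v1⟩ := hasGrad_gradR hx
  have gr := HasGrad.of_differentiableAt (hasGrad_coeff S.contDiffOn_R hx).1
  have ss := (HasGrad.sin_two (x := x)).mul HasGrad.sin_two
  have l0 := ((gr.mul v0).mul ss).neg.pd_eq
  have l1 := ((gr.mul v1).mul ss).neg.pd_eq
  have sc := ((HasGrad.sin_two (x := x)).mul HasGrad.cos_two).neg.pd_eq
  have h0 : ∀ k, pd k (fun _ => (0 : ℝ)) x = 0 := fun k => (HasGrad.const 0).pd_eq k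
  rw [gradSq_radius hx]
  simp only [ricci, Fin.sum_univ_four, riemannUp_self]
  simp only [riemannUp, Fin.sum_univ_four, pd_christoffel_two hx, pd_christoffel_zero hx,
    pd_christoffel_one hx, christoffel_zero hx, christoffel_one hx, christoffel_two hx,
    christoffel_three hx]
  simp [l0, l1, h0, sc, boxR]
  field_simp
  ring

/-- The surface contributes `K g_{AB}`, and each of the two angular directions `-∇_A∇_B R / R`. -/
theorem ricci_orbit (hx : x ∈ S.domain) :
    ricci S.metric 0 0 x = S.gaussCurv x * radial S.g00 x - 2 * (S.hess00 x / radial S.R x) ∧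
    ricci S.metric 0 1 x = S.gaussCurv x * radial S.g01 x - 2 * (S.hess01 x / radial S.R x) ∧
    ricci S.metric 1 0 x = S.gaussCurv x * radial S.g01 x - 2 * (S.hess01 x / radial S.R x) ∧
    ricci S.metric 1 1 x = S.gaussCurv x * radial S.g11 x - 2 * (S.hess11 x / radial S.R x) := by
  obtain ⟨w00, w01, w10, w11⟩ := riemannUp_gaussCurv hx
  obtain ⟨t00, t01, t10, t11⟩ := riemannUp_two_orbit hx
  obtain ⟨p00, p01, p10, p11⟩ := riemannUp_three_orbit hx
  simp only [ricci, Fin.sum_univ_four, riemannUp_self, riemannUp_swap S.metric _ _ 0 1, w00, w01,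
    w10, w11, t00, t01, t10, t11, p00, p01, p10, p11]
  refine ⟨?_, ?_, ?_, ?_⟩ <;> ring

theorem scalarCurv_eq (hx : x ∈ S.domain) : scalarCurv S.metric x =
    2 * S.gaussCurv x - 4 * (S.boxR x / radial S.R x)
      + 2 * ((1 - gradSq S.metric S.radius x) / radial S.R x ^ 2) := by
  have hd := (orbitDet_neg hx).ne
  have hr := (radial_R_pos hx).ne'
  have hs := (sin_pos hx).ne'
  obtain ⟨r00, r01, r10, r11⟩ := ricci_orbit hx
  have hb : S.boxR x = (radial S.g11 x * S.hess00 x - 2 * radial S.g01 x * S.hess01 x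
      + radial S.g00 x * S.hess11 x) / S.orbitDet x := by
    rw [← orbitDet_mul_boxR hx]; field_simp
  -- The determinant must be expanded only next to `K`, where the trace of the orbit metric arises.
  have hk : S.gaussCurv x * S.orbitDet x = S.gaussCurv x *
    (radial S.g00 x * radial S.g11 x - radial S.g01 x * radial S.g01 x) := rfl
  simp [scalarCurv, Fin.sum_univ_four, inv_metric hx, r00, r01, r10, r11, ricci_two_two hx,
    ricci_three_three hx]
  rw [hb]
  field_simp
  linear_combination (-2 * radial S.R x ^ 2) * hk

/-- The components of the Riemann tensor along the orbit space. -/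
theorem riemann_orbit (hx : x ∈ S.domain) {a b c d : Fin 4} (ha : a = 0 ∨ a = 1)
    (hb : b = 0 ∨ b = 1) (hc : c = 0 ∨ c = 1) (hd : d = 0 ∨ d = 1) :
    riemann S.metric a b c d x = S.gaussCurv x *
      (S.metric x a c * S.metric x b d - S.metric x a d * S.metric x b c) := by
  obtain ⟨w00, w01, w10, w11⟩ := riemannUp_gaussCurv hx
  rcases ha with rfl | rfl <;> rcases hb with rfl | rfl <;> rcases hc with rfl | rfl <;>
    rcases hd with rfl | rfl <;>
    simp [riemann, Fin.sum_univ_four, riemannUp_self, riemannUp_swap S.metric _ _ 0 1, metric_eq,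
      w00, w01, w10, w11] <;>
    ring

end SphericalSpacetime

end

end OneOneTwo

/-! ### Projections and the radial frame. -/

namespace OneOneTwo

noncomputable section

/-- Contraction of a covariant two-tensor with `e` after taking its projected symmetric trace-free
part. -/
theorem alongE_pstf {g : Tensor2} {u e : VField} {x : Pt} (W : Fin 4 → Fin 4 → ℝ)
    (hP : ∀ c, ∑ a, hMix g u c a x * e x a = e x c)
    (hQ : ∑ a, ∑ b, hDown g u a b x * e x a * e x b = 1) :
    alongE e (fun a b => pstf g u W a b x) x =
      alongE e W x - 1 / 3 * ∑ c, ∑ d, hUp g u c d x * W c d := by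
  have comm : ∀ f : Fin 4 → Fin 4 → Fin 4 → Fin 4 → ℝ,
      ∑ a, ∑ b, ∑ c, ∑ d, f a b c d = ∑ c, ∑ d, ∑ a, ∑ b, f a b c d := by
    intro f
    rw [Finset.sum_congr rfl fun a _ => Finset.sum_comm, Finset.sum_comm]
    refine Finset.sum_congr rfl fun c _ => ?_
    rw [Finset.sum_congr rfl fun a _ => Finset.sum_comm, Finset.sum_comm]
  -- Contracting with `e` first: `h e = e` merges the two symmetrized halves into `W(e,e)`, and
  -- `h(e,e) = 1` leaves the trace with its factor `1/3`.
  have inner : ∀ c d, ∑ a, ∑ b,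
      ((1 / 2) * (hMix g u c a x * hMix g u d b x + hMix g u c b x * hMix g u d a x)
        - (1 / 3) * hDown g u a b x * hUp g u c d x) * W c d * e x a * e x b =
      W c d * e x c * e x d - 1 / 3 * (hUp g u c d x * W c d) := by
    intro c d
    calc _ = W c d * (∑ a, hMix g u c a x * e x a) * (∑ b, hMix g u d b x * e x b)
          - 1 / 3 * ((∑ a, ∑ b, hDown g u a b x * e x a * e x b) * (hUp g u c d x * W c d)) := by
          simp only [Fin.sum_univ_four]
          ring
      _ = _ := by rw [hP, hP, hQ, one_mul]
  simp only [alongE, pstf, Finset.sum_mul]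
  rw [comm]
  simp only [inner, Finset.sum_sub_distrib, Finset.mul_sum]

/-- Trace of the projected derivative of a vector field. -/
theorem trace_dVec {g : Tensor2} {u : VField} {x : Pt} (v : VField)
    (hu : ∑ a, lower g u x a * u x a = -1) :
    ∑ a, dVec g u v a a x = ∑ r, ∑ f, hMix g u r f x * covVec g v r f x := by
  -- `h` is idempotent because `u_a u^a = -1`, so under the trace the two projections reduce to one.
  have hh : ∀ r f, ∑ a, hMix g u r a x * hMix g u a f x = hMix g u r f x := by
    intro r f
    have : ∀ a, hMix g u r a x * hMix g u a f x =
        (if r = a then hMix g u a f x else 0) + (if a = f then u x r * lower g u x a else 0)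
          + u x r * lower g u x f * (lower g u x a * u x a) := by
      intro a
      simp only [hMix]
      split_ifs <;> ring
    simp only [this, Finset.sum_add_distrib, ← Finset.mul_sum, hu, Finset.sum_ite_eq,
      Finset.sum_ite_eq', Finset.mem_univ, if_true]
    simp only [hMix]
    ring
  simp only [dVec]
  rw [Finset.sum_comm]
  refine Finset.sum_congr rfl fun r _ => ?_
  rw [Finset.sum_comm]
  refine Finset.sum_congr rfl fun f _ => ?_
  rw [← hh r f, Finset.sum_mul]

namespace SphericalSpacetime

variable {S : SphericalSpacetime} {x : Pt} (F : S.RadialFrame)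

theorem RadialFrame.u_apply (x : Pt) : F.u x = ![radial F.u0 x, radial F.u1 x, 0, 0] := rfl

theorem RadialFrame.e_apply (x : Pt) : F.e x = ![radial F.e0 x, radial F.e1 x, 0, 0] := rfl

/-- Lowering the index of a field orthogonal to the spheres. -/
theorem lower_radial {v : VField} {v0 v1 : ℝ × ℝ → ℝ}
    (hv : ∀ y, v y = ![radial v0 y, radial v1 y, 0, 0]) (y : Pt) :
    lower S.metric v y = ![radial S.g00 y * radial v0 y + radial S.g01 y * radial v1 y,
      radial S.g01 y * radial v0 y + radial S.g11 y * radial v1 y, 0, 0] := by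
  ext a
  fin_cases a <;> simp [lower, Fin.sum_univ_four, metric_eq, hv]

/-- The component `e_0`. -/
def RadialFrame.lowerE0 (x : Pt) : ℝ :=
  radial S.g00 x * radial F.e0 x + radial S.g01 x * radial F.e1 x

/-- The component `e_1`. -/
def RadialFrame.lowerE1 (x : Pt) : ℝ :=
  radial S.g01 x * radial F.e0 x + radial S.g11 x * radial F.e1 x

/-- The component `u_0`. -/
def RadialFrame.lowerU0 (x : Pt) : ℝ :=
  radial S.g00 x * radial F.u0 x + radial S.g01 x * radial F.u1 x

/-- The component `u_1`. -/
def RadialFrame.lowerU1 (x : Pt) : ℝ :=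
  radial S.g01 x * radial F.u0 x + radial S.g11 x * radial F.u1 x

theorem RadialFrame.lower_u : lower S.metric F.u x = ![F.lowerU0 x, F.lowerU1 x, 0, 0] :=
  lower_radial F.u_apply x

theorem RadialFrame.lower_e : lower S.metric F.e x = ![F.lowerE0 x, F.lowerE1 x, 0, 0] :=
  lower_radial F.e_apply x

variable {F}

theorem RadialFrame.orthonormal (hx : x ∈ S.domain) :
    F.lowerU0 x * radial F.u0 x + F.lowerU1 x * radial F.u1 x = -1 ∧
    F.lowerE0 x * radial F.e0 x + F.lowerE1 x * radial F.e1 x = 1 ∧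
    F.lowerU0 x * radial F.e0 x + F.lowerU1 x * radial F.e1 x = 0 ∧
    F.lowerE0 x * radial F.u0 x + F.lowerE1 x * radial F.u1 x = 0 := by
  have h1 := F.unit_u _ hx.1
  have h2 := F.unit_e _ hx.1
  have h3 := F.orthogonal _ hx.1
  simp only [lowerU0, lowerU1, lowerE0, lowerE1, radial]
  refine ⟨?_, ?_, ?_, ?_⟩
  · linear_combination h1
  · linear_combination h2
  · linear_combination h3
  · linear_combination h3

/-- Completeness of the frame on the orbit space: `-u^A u_B + e^A e_B = δ^A_B`. -/
theorem RadialFrame.complete (hx : x ∈ S.domain) :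
    -(radial F.u0 x * F.lowerU0 x) + radial F.e0 x * F.lowerE0 x = 1 ∧
    -(radial F.u0 x * F.lowerU1 x) + radial F.e0 x * F.lowerE1 x = 0 ∧
    -(radial F.u1 x * F.lowerU0 x) + radial F.e1 x * F.lowerE0 x = 0 ∧
    -(radial F.u1 x * F.lowerU1 x) + radial F.e1 x * F.lowerE1 x = 1 := by
  obtain ⟨h1, h2, h3, h4⟩ := F.orthonormal hx
  -- Orthonormality says that the coframe `(-u_A, e_A)` is a left inverse of the frame; for square
  -- matrices it is also a right inverse, which is completeness.
  have h : !![-F.lowerU0 x, -F.lowerU1 x; F.lowerE0 x, F.lowerE1 x] *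
      !![radial F.u0 x, radial F.e0 x; radial F.u1 x, radial F.e1 x] = 1 := by
    ext i j
    fin_cases i <;> fin_cases j <;> simp [Matrix.mul_apply, Fin.sum_univ_two] <;> linarith
  have h' := mul_eq_one_comm.mp h
  have e := fun i j => congrFun (congrFun h' i) j
  have e00 := e 0 0
  have e01 := e 0 1
  have e10 := e 1 0
  have e11 := e 1 1
  simp [Matrix.mul_apply, Fin.sum_univ_two] at e00 e01 e10 e11
  exact ⟨by linarith, by linarith, by linarith, by linarith⟩

/-- The frame components of the inverse metric of the orbit space. -/
theorem RadialFrame.inv_eq (hx : x ∈ S.domain) :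
    radial S.g11 x / S.orbitDet x = -(radial F.u0 x * radial F.u0 x)
      + radial F.e0 x * radial F.e0 x ∧
    -radial S.g01 x / S.orbitDet x = -(radial F.u0 x * radial F.u1 x)
      + radial F.e0 x * radial F.e1 x ∧
    radial S.g00 x / S.orbitDet x = -(radial F.u1 x * radial F.u1 x)
      + radial F.e1 x * radial F.e1 x := by
  obtain ⟨h1, h2, h3, h4⟩ := F.complete hx
  have hd := (orbitDet_neg hx).ne
  simp only [lowerU0, lowerU1, lowerE0, lowerE1] at h1 h2 h3 h4
  refine ⟨?_, ?_, ?_⟩ <;> field_simp <;> simp only [orbitDet]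
  · linear_combination -radial S.g11 x * h1 + radial S.g01 x * h2
  · linear_combination radial S.g01 x * h1 - radial S.g00 x * h2
  · linear_combination radial S.g01 x * h3 - radial S.g00 x * h4

variable (F)

theorem RadialFrame.hMix_eq (hx : x ∈ S.domain) (a b : Fin 4) : hMix S.metric F.u a b x =
    !![radial F.e0 x * F.lowerE0 x, radial F.e0 x * F.lowerE1 x, 0, 0;
       radial F.e1 x * F.lowerE0 x, radial F.e1 x * F.lowerE1 x, 0, 0;
       0, 0, 1, 0; 0, 0, 0, 1] a b := by
  obtain ⟨h1, h2, h3, h4⟩ := F.complete hx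
  simp only [hMix, F.lower_u, F.u_apply]
  fin_cases a <;> fin_cases b <;> simp <;> linarith

theorem RadialFrame.nMix_eq (hx : x ∈ S.domain) (a b : Fin 4) : nMix S.metric F.u F.e a b x =
    !![0, 0, 0, 0; 0, 0, 0, 0; 0, 0, 1, 0; 0, 0, 0, 1] a b := by
  simp only [nMix, F.hMix_eq hx, F.lower_e, F.e_apply]
  fin_cases a <;> fin_cases b <;> simp

theorem RadialFrame.nUp_eq (hx : x ∈ S.domain) (a b : Fin 4) : nUp S.metric F.u F.e a b x =
    !![0, 0, 0, 0; 0, 0, 0, 0; 0, 0, 1 / (radial S.R x * radial S.R x), 0;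
       0, 0, 0, 1 / (radial S.R x * radial S.R x * (Real.sin (x 2) * Real.sin (x 2)))] a b := by
  obtain ⟨h1, h2, h3⟩ := F.inv_eq hx
  simp only [nUp, hUp, inv_metric hx, h1, h2, h3, F.u_apply, F.e_apply]
  fin_cases a <;> fin_cases b <;> simp
  ring

theorem RadialFrame.hUp_eq (hx : x ∈ S.domain) (a b : Fin 4) : hUp S.metric F.u a b x =
    !![radial F.e0 x * radial F.e0 x, radial F.e0 x * radial F.e1 x, 0, 0;
       radial F.e0 x * radial F.e1 x, radial F.e1 x * radial F.e1 x, 0, 0;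
       0, 0, 1 / (radial S.R x * radial S.R x), 0;
       0, 0, 0, 1 / (radial S.R x * radial S.R x * (Real.sin (x 2) * Real.sin (x 2)))] a b := by
  have h : hUp S.metric F.u a b x = nUp S.metric F.u F.e a b x + F.e x a * F.e x b := by
    rw [nUp]; ring
  rw [h, F.nUp_eq hx]
  simp only [F.e_apply]
  fin_cases a <;> fin_cases b <;> simp [mul_comm]

theorem RadialFrame.alongE_eq (W : Fin 4 → Fin 4 → ℝ) : alongE F.e W x =
    W 0 0 * radial F.e0 x * radial F.e0 x + W 0 1 * radial F.e0 x * radial F.e1 x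
      + W 1 0 * radial F.e1 x * radial F.e0 x + W 1 1 * radial F.e1 x * radial F.e1 x := by
  simp [alongE, Fin.sum_univ_four, F.e_apply]
  ring

/-- The projected symmetric trace-free part of a tensor, contracted with `e`. -/
theorem RadialFrame.alongE_pstf (hx : x ∈ S.domain) (W : Fin 4 → Fin 4 → ℝ) :
    alongE F.e (fun a b => pstf S.metric F.u W a b x) x = 2 / 3 * alongE F.e W x
      - 1 / 3 * (W 2 2 / (radial S.R x * radial S.R x)
        + W 3 3 / (radial S.R x * radial S.R x * (Real.sin (x 2) * Real.sin (x 2)))) := by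
  obtain ⟨h1, h2, h3, h4⟩ := F.orthonormal hx
  rw [OneOneTwo.alongE_pstf]
  · rw [F.alongE_eq]
    simp [Fin.sum_univ_four, F.hUp_eq hx]
    ring
  · intro c
    fin_cases c <;> simp [Fin.sum_univ_four, F.hMix_eq hx, F.e_apply]
    · linear_combination radial F.e0 x * h2
    · linear_combination radial F.e1 x * h2
  · simp only [lowerE0, lowerE1] at h2
    simp [Fin.sum_univ_four, hDown, metric_eq, F.e_apply, F.lower_u]
    linear_combination h2 + (F.lowerU0 x * radial F.e0 x + F.lowerU1 x * radial F.e1 x) * h3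

/-- The covariant derivative, along the spheres, of a field orthogonal to them. -/
theorem covCovec_sphere (hx : x ∈ S.domain) {v : VField} {v0 v1 : ℝ × ℝ → ℝ}
    (hv : ∀ y, v y = ![radial v0 y, radial v1 y, 0, 0]) :
    covCovec S.metric (lower S.metric v) 2 2 x = radial S.R x *
      (pd 0 (radial S.R) x * radial v0 x + pd 1 (radial S.R) x * radial v1 x) ∧
    covCovec S.metric (lower S.metric v) 3 3 x = radial S.R x *
      (pd 0 (radial S.R) x * radial v0 x + pd 1 (radial S.R) x * radial v1 x) *
      (Real.sin (x 2) * Real.sin (x 2)) := by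
  have h0 : ∀ k, pd k (fun _ => (0 : ℝ)) x = 0 := fun k => (HasGrad.const 0).pd_eq k
  obtain ⟨d0, d1⟩ := pd_R_eq hx
  -- The angular components vanish identically, so only the Christoffel terms `R ∇^A R v_A` survive.
  simp only [covCovec, lower_radial hv, Fin.sum_univ_four, christoffel_zero hx,
    christoffel_one hx, christoffel_two hx, christoffel_three hx]
  rw [d0, d1]
  constructor <;> simp [h0] <;> ring

theorem covVec_sphere (hx : x ∈ S.domain) {v : VField} {v0 v1 : ℝ × ℝ → ℝ}
    (hv : ∀ y, v y = ![radial v0 y, radial v1 y, 0, 0]) :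
    covVec S.metric v 2 2 x =
      (pd 0 (radial S.R) x * radial v0 x + pd 1 (radial S.R) x * radial v1 x) / radial S.R x ∧
    covVec S.metric v 3 3 x =
      (pd 0 (radial S.R) x * radial v0 x + pd 1 (radial S.R) x * radial v1 x) / radial S.R x := by
  have h0 : ∀ k, pd k (fun _ => (0 : ℝ)) x = 0 := fun k => (HasGrad.const 0).pd_eq k
  simp only [covVec, hv, Fin.sum_univ_four, christoffel_two hx, christoffel_three hx]
  constructor <;> simp [h0] <;> ring

/-- Lowering an index commutes with covariant differentiation on the orbit space. -/
theorem covCovec_lower_orbit (hx : x ∈ S.domain) {v : VField} {v0 v1 : ℝ × ℝ → ℝ}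
    (hv : ∀ y, v y = ![radial v0 y, radial v1 y, 0, 0])
    (h0 : ContDiffOn ℝ 1 v0 S.base) (h1 : ContDiffOn ℝ 1 v1 S.base) :
    (covCovec S.metric (lower S.metric v) 0 0 x = radial S.g00 x * covVec S.metric v 0 0 x
      + radial S.g01 x * covVec S.metric v 0 1 x) ∧
    (covCovec S.metric (lower S.metric v) 0 1 x = radial S.g01 x * covVec S.metric v 0 0 x
      + radial S.g11 x * covVec S.metric v 0 1 x) ∧
    (covCovec S.metric (lower S.metric v) 1 0 x = radial S.g00 x * covVec S.metric v 1 0 x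
      + radial S.g01 x * covVec S.metric v 1 1 x) ∧
    covCovec S.metric (lower S.metric v) 1 1 x = radial S.g01 x * covVec S.metric v 1 0 x
      + radial S.g11 x * covVec S.metric v 1 1 x := by
  have d0 := HasGrad.of_differentiableAt (HasGrad.radial
    ((h0.contDiffAt (S.isOpen_base.mem_nhds hx.1)).differentiableAt (by norm_num))).1
  have d1 := HasGrad.of_differentiableAt (HasGrad.radial
    ((h1.contDiffAt (S.isOpen_base.mem_nhds hx.1)).differentiableAt (by norm_num))).1
  have p0 := pd_lower S.contDiffOn_g00 S.contDiffOn_g01 d0 d1 hx (fun y _ => rfl)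
  have p1 := pd_lower S.contDiffOn_g01 S.contDiffOn_g11 d0 d1 hx (fun y _ => rfl)
  obtain ⟨e1, e2, e3, e4, e5, e6⟩ := pd_coeff_eq hx
  simp only [covCovec, covVec, lower_radial hv, hv, Fin.sum_univ_four, christoffel_zero hx,
    christoffel_one hx, christoffel_two hx, christoffel_three hx]
  refine ⟨?_, ?_, ?_, ?_⟩ <;> simp [p0, p1, e1, e2, e3, e4, e5, e6] <;> ring

end SphericalSpacetime

end

end OneOneTwo

/-! ### The scalars of the decomposition in terms of the area radius and the curvature. -/

namespace OneOneTwo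

noncomputable section

namespace SphericalSpacetime

variable {S : SphericalSpacetime} {x : Pt} (F : S.RadialFrame)

/-- The derivative `u(R)` of the area radius. -/
def RadialFrame.uR (x : Pt) : ℝ :=
  pd 0 (radial S.R) x * radial F.u0 x + pd 1 (radial S.R) x * radial F.u1 x

/-- The derivative `e(R)` of the area radius. -/
def RadialFrame.eR (x : Pt) : ℝ :=
  pd 0 (radial S.R) x * radial F.e0 x + pd 1 (radial S.R) x * radial F.e1 x

theorem RadialFrame.gradSq_eq (hx : x ∈ S.domain) :
    gradSq S.metric S.radius x = F.eR x ^ 2 - F.uR x ^ 2 := by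
  obtain ⟨h1, h2, h3⟩ := F.inv_eq hx
  rw [gradSq_radius hx, eR, uR]
  have e0 : S.gradR0 x = radial S.g11 x / S.orbitDet x * pd 0 (radial S.R) x
      + -radial S.g01 x / S.orbitDet x * pd 1 (radial S.R) x := by rw [gradR0]; ring
  have e1 : S.gradR1 x = radial S.g00 x / S.orbitDet x * pd 1 (radial S.R) x
      + -radial S.g01 x / S.orbitDet x * pd 0 (radial S.R) x := by rw [gradR1]; ring
  rw [e0, e1, h1, h2, h3]
  ring

theorem RadialFrame.sheetExpansion_eq (hx : x ∈ S.domain) :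
    sheetExpansion S.metric F.u F.e x = 2 * (F.eR x / radial S.R x) := by
  obtain ⟨h2, h3⟩ := covVec_sphere hx F.e_apply
  simp [sheetExpansion, deltaVec, dVec, Fin.sum_univ_four, F.nMix_eq hx, F.hMix_eq hx, h2, h3, eR]
  ring

/-- The trace with `h = ee + N` splits into a radial part and two equal angular parts `u(R)/R`. -/
theorem RadialFrame.expansion_eq (hx : x ∈ S.domain) : expansion S.metric F.u x =
    alongE F.e (fun a b => covCovec S.metric (lower S.metric F.u) a b x) x
      + 2 * (F.uR x / radial S.R x) := by
  obtain ⟨h1, -, -, -⟩ := F.orthonormal hx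
  obtain ⟨h2, h3⟩ := covVec_sphere hx F.u_apply
  obtain ⟨c00, c01, c10, c11⟩ :=
    covCovec_lower_orbit hx F.u_apply F.contDiffOn_u0 F.contDiffOn_u1
  rw [expansion, trace_dVec, F.alongE_eq, c00, c01, c10, c11]
  · simp [Fin.sum_univ_four, F.hMix_eq hx, h2, h3, uR, lowerE0, lowerE1]
    ring
  · simp [Fin.sum_univ_four, F.lower_u, F.u_apply, h1]

theorem RadialFrame.shearScalar_eq (hx : x ∈ S.domain) : shearScalar S.metric F.u F.e x =
    2 / 3 * alongE F.e (fun a b => covCovec S.metric (lower S.metric F.u) a b x) x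
      - 2 / 3 * (F.uR x / radial S.R x) := by
  have hr := (radial_R_pos hx).ne'
  have hs := (sin_pos hx).ne'
  obtain ⟨-, h1, -, -⟩ := F.orthonormal hx
  obtain ⟨h2, h3⟩ := covCovec_sphere hx F.u_apply
  have d2 : dCovec S.metric F.u (lower S.metric F.u) 2 2 x
      = covCovec S.metric (lower S.metric F.u) 2 2 x := by
    simp [dCovec, Fin.sum_univ_four, F.hMix_eq hx]
  have d3 : dCovec S.metric F.u (lower S.metric F.u) 3 3 x
      = covCovec S.metric (lower S.metric F.u) 3 3 x := by
    simp [dCovec, Fin.sum_univ_four, F.hMix_eq hx]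
  -- Each of the two projections in `D` contributes a factor `e_a e^a`, which is 1.
  have de : alongE F.e (fun a b => dCovec S.metric F.u (lower S.metric F.u) a b x) x
      = (F.lowerE0 x * radial F.e0 x + F.lowerE1 x * radial F.e1 x) ^ 2 *
        alongE F.e (fun a b => covCovec S.metric (lower S.metric F.u) a b x) x := by
    rw [F.alongE_eq, F.alongE_eq]
    simp [dCovec, Fin.sum_univ_four, F.hMix_eq hx]
    ring
  simp only [shearScalar, shear]
  rw [F.alongE_pstf hx, de, h1, d2, d3, h2, h3, ← uR]
  field_simp
  ring

/-- The radial part `e^a e^b ∇_a u_b` enters both terms with weight `2/3` and cancels, so no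
derivative of `u` remains. -/
theorem RadialFrame.shearScalar_sub_expansion (hx : x ∈ S.domain) :
    shearScalar S.metric F.u F.e x - 2 / 3 * expansion S.metric F.u x
      = -(2 * (F.uR x / radial S.R x)) := by
  rw [F.shearScalar_eq hx, F.expansion_eq hx]
  ring

theorem RadialFrame.sheetExpansionAlong_eq (hx : x ∈ S.domain) {k : VField} {k0 k1 : ℝ × ℝ → ℝ}
    (hk : ∀ y, k y = ![radial k0 y, radial k1 y, 0, 0]) :
    sheetExpansionAlong S.metric F.u F.e k x = 2 *
      ((pd 0 (radial S.R) x * radial k0 x + pd 1 (radial S.R) x * radial k1 x)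
        / radial S.R x) := by
  have hr := (radial_R_pos hx).ne'
  have hs := (sin_pos hx).ne'
  obtain ⟨h2, h3⟩ := covCovec_sphere hx hk
  simp [sheetExpansionAlong, Fin.sum_univ_four, F.nUp_eq hx, h2, h3]
  field_simp
  ring

theorem RadialFrame.kineticGeom_eq (hx : x ∈ S.domain) : kineticGeom S.metric F.u F.e x =
    4 * gradSq S.metric S.radius x / radial S.R x ^ 2 := by
  rw [kineticGeom, F.sheetExpansion_eq hx, F.shearScalar_sub_expansion hx, F.gradSq_eq hx]
  ring

/-- `G` factors as `-(u(R) + e(R))(u(R) - e(R))`, and up to `2/R` the factors are the two null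
expansions. -/
theorem RadialFrame.isHorizonAt_iff (hx : x ∈ S.domain) :
    IsHorizonAt S.metric F.u F.e x ↔ gradSq S.metric S.radius x = 0 := by
  have hr := (radial_R_pos hx).ne'
  have hp : ∀ y, F.u y + F.e y = ![radial (F.u0 + F.e0) y, radial (F.u1 + F.e1) y, 0, 0] := by
    intro y; ext a
    fin_cases a <;> simp [F.u_apply, F.e_apply, radial]
  have hm : ∀ y, F.u y - F.e y = ![radial (F.u0 - F.e0) y, radial (F.u1 - F.e1) y, 0, 0] := by
    intro y; ext a
    fin_cases a <;> simp [F.u_apply, F.e_apply, radial]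
  have ep : sheetExpansionAlong S.metric F.u F.e (fun y a => F.u y a + F.e y a) x
      = 2 * ((F.uR x + F.eR x) / radial S.R x) := by
    refine (F.sheetExpansionAlong_eq hx hp).trans ?_
    simp only [radial, Pi.add_apply, uR, eR]
    ring
  have em : sheetExpansionAlong S.metric F.u F.e (fun y a => F.u y a - F.e y a) x
      = 2 * ((F.uR x - F.eR x) / radial S.R x) := by
    refine (F.sheetExpansionAlong_eq hx hm).trans ?_
    simp only [radial, Pi.sub_apply, uR, eR]
    ring
  rw [IsHorizonAt, ep, em, F.gradSq_eq hx]
  have hf : F.eR x ^ 2 - F.uR x ^ 2 = -((F.uR x + F.eR x) * (F.uR x - F.eR x)) := by ring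
  rw [hf, neg_eq_zero, mul_eq_zero]
  simp [hr]

/-- The Hessian of the area radius along `u`. -/
def RadialFrame.hessU (x : Pt) : ℝ := S.hess00 x * radial F.u0 x ^ 2
  + 2 * S.hess01 x * radial F.u0 x * radial F.u1 x + S.hess11 x * radial F.u1 x ^ 2

/-- The Hessian of the area radius along `e`. -/
def RadialFrame.hessE (x : Pt) : ℝ := S.hess00 x * radial F.e0 x ^ 2
  + 2 * S.hess01 x * radial F.e0 x * radial F.e1 x + S.hess11 x * radial F.e1 x ^ 2

theorem RadialFrame.boxR_eq (hx : x ∈ S.domain) : S.boxR x = F.hessE x - F.hessU x := by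
  obtain ⟨h1, h2, h3⟩ := F.inv_eq hx
  have hd := (orbitDet_neg hx).ne
  have hb : S.boxR x = radial S.g11 x / S.orbitDet x * S.hess00 x
      + 2 * (-radial S.g01 x / S.orbitDet x) * S.hess01 x
      + radial S.g00 x / S.orbitDet x * S.hess11 x := by
    have := orbitDet_mul_boxR hx
    field_simp
    linear_combination this
  rw [hb, h1, h2, h3, hessE, hessU]
  ring

variable (S x) in
/-- The metric of the orbit space as a bilinear form. -/
def orbitForm (p0 p1 q0 q1 : ℝ) : ℝ :=
  radial S.g00 x * p0 * q0 + radial S.g01 x * (p0 * q1 + p1 * q0) + radial S.g11 x * p1 * q1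

theorem RadialFrame.orbitForm_eq (hx : x ∈ S.domain) :
    orbitForm S x (radial F.u0 x) (radial F.u1 x) (radial F.u0 x) (radial F.u1 x) = -1 ∧
    orbitForm S x (radial F.e0 x) (radial F.e1 x) (radial F.e0 x) (radial F.e1 x) = 1 ∧
    orbitForm S x (radial F.u0 x) (radial F.u1 x) (radial F.e0 x) (radial F.e1 x) = 0 := by
  have h1 := F.unit_u _ hx.1
  have h2 := F.unit_e _ hx.1
  have h3 := F.orthogonal _ hx.1
  simp only [orbitForm, radial]
  exact ⟨by linear_combination h1, by linear_combination h2, by linear_combination h3⟩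

/-- The sectional term gives `-K`, the Ricci terms give `K - □R/R`; the Gaussian curvature remains
only inside the Ricci scalar. -/
theorem RadialFrame.weylScalar_eq (hx : x ∈ S.domain) : weylScalar S.metric F.u F.e x =
    -(S.boxR x / radial S.R x) - 1 / 6 * scalarCurv S.metric x := by
  obtain ⟨huu, hee, hue⟩ := F.orbitForm_eq hx
  obtain ⟨r00, r01, r10, r11⟩ := ricci_orbit hx
  -- Before the frame is normalized this is a polynomial identity, so `ring` proves it;
  -- orthonormality is substituted afterwards.
  have h : weylScalar S.metric F.u F.e x =
      (S.gaussCurv x + 1 / 6 * scalarCurv S.metric x) *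
        (orbitForm S x (radial F.e0 x) (radial F.e1 x) (radial F.e0 x) (radial F.e1 x)
          * orbitForm S x (radial F.u0 x) (radial F.u1 x) (radial F.u0 x) (radial F.u1 x)
          - orbitForm S x (radial F.u0 x) (radial F.u1 x) (radial F.e0 x) (radial F.e1 x) ^ 2)
      - 1 / 2 * (orbitForm S x (radial F.e0 x) (radial F.e1 x) (radial F.e0 x) (radial F.e1 x)
          * (ricci S.metric 0 0 x * radial F.u0 x ^ 2 + 2 * ricci S.metric 0 1 x * radial F.u0 x
            * radial F.u1 x + ricci S.metric 1 1 x * radial F.u1 x ^ 2)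
        - 2 * orbitForm S x (radial F.u0 x) (radial F.u1 x) (radial F.e0 x) (radial F.e1 x)
          * (ricci S.metric 0 0 x * radial F.u0 x * radial F.e0 x + ricci S.metric 0 1 x
            * (radial F.u0 x * radial F.e1 x + radial F.u1 x * radial F.e0 x)
            + ricci S.metric 1 1 x * radial F.u1 x * radial F.e1 x)
        + orbitForm S x (radial F.u0 x) (radial F.u1 x) (radial F.u0 x) (radial F.u1 x)
          * (ricci S.metric 0 0 x * radial F.e0 x ^ 2 + 2 * ricci S.metric 0 1 x * radial F.e0 x
            * radial F.e1 x + ricci S.metric 1 1 x * radial F.e1 x ^ 2)) := by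
    have e10 : ricci S.metric 1 0 x = ricci S.metric 0 1 x := by rw [r10, r01]
    rw [weylScalar, F.alongE_eq]
    simp [electricWeyl, Fin.sum_univ_four, F.u_apply, weyl, riemann_orbit hx, metric_eq, e10]
    simp only [orbitForm]
    ring
  rw [h, huu, hee, hue, r00, r01, r11, F.boxR_eq hx, hessE, hessU]
  simp only [orbitForm] at huu hee
  linear_combination (-1 / 2) * S.gaussCurv x * huu + 1 / 2 * S.gaussCurv x * hee

variable {F} {T : Tensor2}

theorem RadialFrame.energyDensity_eq (hT : S.FieldEquations T) (hx : x ∈ S.domain) :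
    energyDensity F.u T x = -S.gaussCurv x - 2 * (F.hessU x / radial S.R x)
      + 1 / 2 * scalarCurv S.metric x := by
  obtain ⟨huu, -, -⟩ := F.orbitForm_eq hx
  obtain ⟨r00, r01, r10, r11⟩ := ricci_orbit hx
  simp [energyDensity, hT x hx, einstein, Fin.sum_univ_four, F.u_apply, r00, r01, r10, r11,
    metric_eq, hessU]
  simp only [orbitForm] at huu
  linear_combination (S.gaussCurv x - 1 / 2 * scalarCurv S.metric x) * huu

/-- `Π` is `2/3` of the difference between the radial stress and the common angular stress; the
Ricci scalar term is pure trace and drops out. -/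
theorem RadialFrame.anisoScalar_eq (hT : S.FieldEquations T) (hx : x ∈ S.domain) :
    anisoScalar S.metric F.u F.e T x = 2 / 3 * (S.gaussCurv x - 2 * (F.hessE x / radial S.R x)
      - (1 - gradSq S.metric S.radius x) / radial S.R x ^ 2 + S.boxR x / radial S.R x) := by
  have hr := (radial_R_pos hx).ne'
  have hs := (sin_pos hx).ne'
  obtain ⟨-, hee, -⟩ := F.orbitForm_eq hx
  obtain ⟨r00, r01, r10, r11⟩ := ricci_orbit hx
  have h22 : T x 2 2 / (radial S.R x * radial S.R x) =
      (1 - gradSq S.metric S.radius x) / radial S.R x ^ 2 - S.boxR x / radial S.R x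
        - 1 / 2 * scalarCurv S.metric x := by
    simp [hT x hx, einstein, ricci_two_two hx, metric_eq]
    field_simp
  have h33 : T x 3 3 / (radial S.R x * radial S.R x * (Real.sin (x 2) * Real.sin (x 2))) =
      (1 - gradSq S.metric S.radius x) / radial S.R x ^ 2 - S.boxR x / radial S.R x
        - 1 / 2 * scalarCurv S.metric x := by
    simp [hT x hx, einstein, ricci_three_three hx, metric_eq]
    field_simp
  simp only [anisoScalar, anisoStress]
  rw [F.alongE_pstf hx, F.alongE_eq, h22, h33]
  simp [hT x hx, einstein, r00, r01, r10, r11, metric_eq, hessE]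
  simp only [orbitForm] at hee
  linear_combination 2 / 3 * (S.gaussCurv x - 1 / 2 * scalarCurv S.metric x) * hee

/-- The weights `1/3, -1, -1/2` are those for which `K` and `□R` cancel; what is left is `2M/R³`. -/
theorem RadialFrame.potentialGeom_eq (hT : S.FieldEquations T) (hx : x ∈ S.domain) :
    potentialGeom S.metric F.u F.e T x =
      (1 - gradSq S.metric S.radius x) / radial S.R x ^ 2 := by
  rw [potentialGeom, F.energyDensity_eq hT hx, F.weylScalar_eq hx, F.anisoScalar_eq hT hx,
    scalarCurv_eq hx, F.boxR_eq hx]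
  ring

theorem compactness_eq (hx : x ∈ S.domain) :
    S.compactness x = (1 - gradSq S.metric S.radius x) / 2 := by
  have hr : S.radius x ≠ 0 := (radial_R_pos hx).ne'
  rw [compactness, mass]
  field_simp

end SphericalSpacetime

end

end OneOneTwo

/-! ### The proposition: algebra in the compactness. -/

theorem proposition1 (S : SphericalSpacetime) (F : S.RadialFrame) (T : Tensor2)
    (hT : S.FieldEquations T) (x : Pt) (hx : x ∈ S.domain) :
    (S.compactness x ≠ 0 →
      sheetExpansion S.metric F.u F.e x ^ 2
          - (shearScalar S.metric F.u F.e x - (2 / 3) * expansion S.metric F.u x) ^ 2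
        = 2 * (1 - 2 * S.compactness x) / S.compactness x
          * ((1 / 3) * energyDensity F.u T x - weylScalar S.metric F.u F.e x
              - (1 / 2) * anisoScalar S.metric F.u F.e T x)) ∧
    (S.compactness x * kineticGeom S.metric F.u F.e x
        = 2 * (1 - 2 * S.compactness x) * potentialGeom S.metric F.u F.e T x) ∧
    (S.compactness x = 4 / 9 →
      2 * (1 - 2 * S.compactness x) / S.compactness x = 1 / 2) ∧
    (kineticGeom S.metric F.u F.e x = (1 / 2) * potentialGeom S.metric F.u F.e T x ↔
      S.compactness x = 4 / 9) ∧
    (kineticGeom S.metric F.u F.e x = 0 ↔ S.compactness x = 1 / 2) ∧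
    (kineticGeom S.metric F.u F.e x = 0 ↔ IsHorizonAt S.metric F.u F.e x) := by
  have hr := (SphericalSpacetime.radial_R_pos hx).ne'
  have hα := SphericalSpacetime.compactness_eq hx
  have hG : gradSq S.metric S.radius x = 1 - 2 * S.compactness x := by linarith
  have hK := F.kineticGeom_eq hx
  have hV := SphericalSpacetime.RadialFrame.potentialGeom_eq (F := F) hT hx
  have hV' : potentialGeom S.metric F.u F.e T x = 2 * S.compactness x / radial S.R x ^ 2 := by
    rw [hV, hG]
    ring
  have hH := F.isHorizonAt_iff hx
  rw [hG] at hK hH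
  have h2 : S.compactness x * kineticGeom S.metric F.u F.e x
      = 2 * (1 - 2 * S.compactness x) * potentialGeom S.metric F.u F.e T x := by
    rw [hK, hV']
    ring
  have h0 : kineticGeom S.metric F.u F.e x = 0 ↔ 1 - 2 * S.compactness x = 0 := by
    rw [hK]
    simp [hr]
  refine ⟨fun hne => ?_, h2, fun h => by rw [h]; norm_num, ?_, ?_, h0.trans hH.symm⟩
  · change kineticGeom S.metric F.u F.e x = _ * potentialGeom S.metric F.u F.e T x
    rw [div_mul_eq_mul_div, eq_div_iff hne, mul_comm, h2]
  · rw [hK, hV']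
    -- With `1/R²` cleared, the condition is `4(1 - 2α) = α`, that is `α = 4/9`.
    field_simp
    constructor <;> intro h <;> linarith
  · rw [h0]
    constructor <;> intro h <;> linarith
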